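/- Let $s\ge 2$. A (geometric) braid on $s$ strands consists of $s$ pairwise disjoint curves $t\mapsto(\gamma_j(t),t)\in\mathbb C\times[0,2\pi]$, $\gamma_j$ continuous, with $\operatorname{Re}\gamma_1(0)<\dots<\operatorname{Re}\gamma_s(0)$ and $\{\gamma_j(2\pi)\}_j=\{\gamma_j(0)\}_j$; braids are considered up to isotopy (through such braids). The closure of a braid is the link $\{(\gamma_j(t),e^{it})/\sqrt{1+|\gamma_j(t)|^2}\}$ in $S^3\subset\mathbb C^2$. Let $B$ be a square braid, i.e. $B$ is isotopic to $w^2$ for some braid $w$ on $s$ strands. A Fourier parametrization of $B$ consists of integers $s_C\ge1$ with $\sum_C s_C=s$, where $C$ runs over the set $\mathscr C$ of components of the closure of $B$, and of real trigonometric polynomials $F_C,G_C$, such that the $s$ curves $$h_{C,j}(t)=F_C\Big(\frac{t+2\pi j}{s_C}\Big)+i\,G_C\Big(\frac{t+2\pi j}{s_C}\Big),\qquad C\in\mathscr C,\ 1\le j\le s_C,\ 0\le t\le 2\pi,$$ are the strands of a braid isotopic to $B$. For $a>0$ and an integer $k\ge 0$ put $$g_a(u,e^{it})=\prod_{C\in\mathscr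 C}\prod_{j=1}^{s_C}\big(u-a\,h_{C,j}(t)\big),\qquad \psi_0(e^{it},e^{-it})=a^s\prod_{C\in\mathscr C}\prod_{j=1}^{s_C}h_{C,j}(t),$$ $$p_{a,k}(u,v,\bar v)=(v\bar v)^{sk}\,g_a\!\left(\frac{u}{(v\bar v)^k},\frac{v}{\sqrt{v\bar v}}\right)\quad(v\ne0).$$ Then there exist a Fourier parametrization of $B$, a real $a_0>0$ and an integer $k_0$ such that for every $0<a\le a_0$: 1. the critical values, with multiplicity, of the polynomials $u\mapsto g_a(u,e^{it})$ are given by $s-1$ smooth functions $v_1(t),\dots,v_{s-1}(t)$ of $t\in\mathbb R$ that vanish nowhere; 2. the image of $\psi_0:S^1\to\mathbb C$ does not contain $0$; 3. for every $k\ge k_0$, $p_{a,k}$ is (extends to) a polynomial in $u,v,\bar v$, and it is a weak realization of the closure $L$ of $B$: as a map $f:\mathbb R^4\to\mathbb R^2$ it satisfies $f(0)=0$, the germ at $0$ of the set of its singular points (where the real derivative is not surjective) lying on $V_f=f^{-1}(0)$ is $\{0\}$, and there is $\rho_0>0$ such that for every $0<\rho\le\rho_0$ the set $V_f\cap S^3_\rho$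 is ambient isotopic to $L$ in $S^3_\rho\approx S^3$ (spheres identified by scaling). -/

import Mathlib

open scoped ContDiff Topology ComplexConjugate

noncomputable section

/-! ### Geometric braids -/

/-- A geometric braid on `s` strands: `s` disjoint curves `t ↦ (strand j t, t)` in
`ℂ × [0, 2π]`, `ℂ = ℝ²`, whose set of end points equals the set of starting points.  The strands are
numbered by the position (the first coordinate) of their starting points.  Only the values at
`t ∈ [0, 2π]` are meaningful. -/
structure GeometricBraid (s : ℕ) where
  strand : Fin s → ℝ → ℂ
  perm : Equiv.Perm (Fin s)
  continuousOn : ∀ j, ContinuousOn (strand j) (Set.Icc 0 (2 * Real.pi))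
  disjoint : ∀ t ∈ Set.Icc (0 : ℝ) (2 * Real.pi), Function.Injective fun j => strand j t
  ordered : StrictMono fun j => (strand j 0).re
  closes : ∀ j, strand (perm j) 0 = strand j (2 * Real.pi)

namespace GeometricBraid

variable {s : ℕ}

/-- Isotopy of braids: a continuous family of geometric braids.  The end points may move, but they
always stay in the order of their first coordinates; as the space of such systems of end points is
contractible, the isotopy classes are exactly the elements of the braid group on `s` strands. -/
def Isotopic (B B' : GeometricBraid s) : Prop :=
  ∃ H : ℝ → GeometricBraid s,
    (∀ j, ContinuousOn (fun x : ℝ × ℝ => (H x.1).strand j x.2)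
      (Set.Icc 0 1 ×ˢ Set.Icc 0 (2 * Real.pi))) ∧
    (∀ j, ∀ t ∈ Set.Icc (0 : ℝ) (2 * Real.pi), (H 0).strand j t = B.strand j t) ∧
    (∀ j, ∀ t ∈ Set.Icc (0 : ℝ) (2 * Real.pi), (H 1).strand j t = B'.strand j t)

/-- The product `w · w`: run through `w` twice, at double speed. -/
def square (w : GeometricBraid s) : GeometricBraid s where
  strand j t := if t ≤ Real.pi then w.strand j (2 * t)
    else w.strand (w.perm j) (2 * t - 2 * Real.pi)
  perm := w.perm * w.perm
  continuousOn j := by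
    have hpi := Real.pi_pos
    refine ContinuousOn.if' ?_ ?_ ?_ ?_
    · rintro a ⟨ha, hfr⟩
      have ha' : a = Real.pi := by
        have := frontier_le_subset_eq (continuous_id (X := ℝ)) continuous_const hfr
        exact this
      subst ha'
      have h1 : Filter.Tendsto (fun t => w.strand j (2 * t))
          (𝓝[Set.Icc 0 (2 * Real.pi) ∩ {t | t ≤ Real.pi}] Real.pi)
          (𝓝 (w.strand j (2 * Real.pi))) := by
        refine (w.continuousOn j (2 * Real.pi) ⟨by positivity, le_rfl⟩).tendsto.comp ?_
        refine tendsto_nhdsWithin_iff.2 ⟨?_, ?_⟩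
        · exact ((continuous_const.mul continuous_id).tendsto Real.pi).mono_left
            nhdsWithin_le_nhds
        · filter_upwards [self_mem_nhdsWithin] with t ht
          have h2 : t ≤ Real.pi := ht.2
          exact ⟨by linarith [ht.1.1], by linarith⟩
      simpa using h1
    · rintro a ⟨ha, hfr⟩
      have ha' : a = Real.pi := by
        have := frontier_le_subset_eq (continuous_id (X := ℝ)) continuous_const hfr
        exact this
      subst ha'
      have h1 : Filter.Tendsto (fun t => w.strand (w.perm j) (2 * t - 2 * Real.pi))
          (𝓝[Set.Icc 0 (2 * Real.pi) ∩ {t | ¬ t ≤ Real.pi}] Real.pi)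
          (𝓝 (w.strand (w.perm j) 0)) := by
        refine (w.continuousOn (w.perm j) 0 ⟨le_rfl, by positivity⟩).tendsto.comp ?_
        refine tendsto_nhdsWithin_iff.2 ⟨?_, ?_⟩
        · have h3 : Continuous fun t : ℝ => 2 * t - 2 * Real.pi := by fun_prop
          have h4 := (h3.tendsto Real.pi).mono_left
            (nhdsWithin_le_nhds (s := Set.Icc 0 (2 * Real.pi) ∩ {t | ¬ t ≤ Real.pi}))
          simpa using h4
        · filter_upwards [self_mem_nhdsWithin] with t ht
          have h2 : ¬ t ≤ Real.pi := ht.2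
          exact ⟨by linarith [not_le.1 h2], by linarith [ht.1.2]⟩
      simpa [w.closes j] using h1
    · refine (w.continuousOn j).comp (by fun_prop) ?_
      rintro t ⟨ht, h2⟩
      have h2 : t ≤ Real.pi := h2
      exact ⟨by linarith [ht.1], by linarith⟩
    · refine (w.continuousOn (w.perm j)).comp (by fun_prop) ?_
      rintro t ⟨ht, h2⟩
      have h2 : ¬ t ≤ Real.pi := h2
      exact ⟨by linarith [not_le.1 h2], by linarith [ht.2]⟩
  disjoint t ht := by
    by_cases h : t ≤ Real.pi
    · simp only [h, if_true]
      exact w.disjoint (2 * t) ⟨by linarith [ht.1], by linarith⟩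
    · simp only [h, if_false]
      exact (w.disjoint (2 * t - 2 * Real.pi)
        ⟨by linarith [not_le.1 h], by linarith [ht.2]⟩).comp w.perm.injective
  ordered := by
    simpa [Real.pi_pos.le] using w.ordered
  closes j := by
    have hpi := Real.pi_pos
    have h : ¬ (2 * Real.pi ≤ Real.pi) := by linarith
    have e : 2 * (2 * Real.pi) - 2 * Real.pi = 2 * Real.pi := by ring
    simp only [hpi.le, if_true, h, if_false, mul_zero, e, Equiv.Perm.coe_mul,
      Function.comp_apply]
    exact w.closes (w.perm j)

/-- A square braid: `B = w²` (as braids, i.e. up to isotopy) for a braid `w`. -/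
def IsSquare (B : GeometricBraid s) : Prop := ∃ w : GeometricBraid s, Isotopic B w.square

end GeometricBraid

/-! ### Links in the 3-sphere -/

/-- `ℂ²` with the Hermitian norm; the coordinates are `u = x 0` and `v = x 1`. -/
abbrev C2 : Type := EuclideanSpace ℂ (Fin 2)

/-- The closure of a braid, as a subset of the unit sphere `S³ ⊆ ℂ²`: the image of
`{(γ_j(t), e^{it})} ⊆ ℂ × S¹` under the orientation preserving diffeomorphism
`(u, e^{it}) ↦ (u, e^{it}) / √(1 + |u|²)` of the open solid torus `ℂ × S¹` onto the
complement in `S³` of the unknotted circle `v = 0` (the braid axis). -/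
def GeometricBraid.closure {s : ℕ} (B : GeometricBraid s) : Set C2 :=
  {x | ∃ j : Fin s, ∃ t ∈ Set.Icc (0 : ℝ) (2 * Real.pi),
    x = ((Real.sqrt (1 + ‖B.strand j t‖ ^ 2) : ℂ))⁻¹ •
      (!₂[B.strand j t, Complex.exp (t * Complex.I)] : C2)}

/-- Two subsets of a space are ambient isotopic. -/
def AmbientIsotopic {X : Type*} [TopologicalSpace X] (K L : Set X) : Prop :=
  ∃ H : unitInterval → X ≃ₜ X,
    (Continuous fun x : unitInterval × X => H x.1 x.2) ∧
    (∀ x, H 0 x = x) ∧ H 1 '' K = L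

/-! ### Mixed polynomials and weak realizations -/

/-- Complex polynomials in `z₀ = u`, `z₁ = v` (variables `Sum.inl i`) and their conjugates
(variables `Sum.inr i`). -/
abbrev MixedPolynomial : Type := MvPolynomial (Fin 2 ⊕ Fin 2) ℂ

/-- The map `ℂ² → ℂ` given by a mixed polynomial; these are exactly the real polynomial maps
`ℝ⁴ → ℝ²`. -/
def MixedPolynomial.toFun (P : MixedPolynomial) (x : C2) : ℂ :=
  MvPolynomial.eval (Sum.elim (fun i => x i) (fun i => conj (x i))) P

/-- The singular set of a map `ℝ⁴ → ℝ²`: the points where the real derivative has rank `< 2`. -/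
def singularSet (f : C2 → ℂ) : Set C2 := {x | ¬ Function.Surjective (fderiv ℝ f x)}

/-- `Σ(f) ∩ V_f = {0}` as germs of sets at the origin. -/
def HasWeaklyIsolatedSingularity (f : C2 → ℂ) : Prop :=
  ∀ᶠ x in 𝓝 (0 : C2), x ∈ singularSet f ∩ f ⁻¹' {0} ↔ x ∈ ({0} : Set C2)

/-- The mixed polynomial `P` is a weak realization of the link `L ⊆ S³`: it vanishes at the origin,
has a weakly isolated singularity there, and `V_P ∩ S³_ρ` is ambient isotopic to `L` in
`S³_ρ ≈ S³` for all small radii `ρ`, spheres being identified by scaling. -/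
def IsWeakRealization (P : MixedPolynomial) (L : Set C2) : Prop :=
  P.toFun 0 = 0 ∧ HasWeaklyIsolatedSingularity P.toFun ∧
    ∃ ρ₀ : ℝ, 0 < ρ₀ ∧ ∀ ρ : ℝ, 0 < ρ → ρ ≤ ρ₀ →
      AmbientIsotopic {x : Metric.sphere (0 : C2) ρ | P.toFun x = 0}
        {x : Metric.sphere (0 : C2) ρ | ∃ y ∈ L, (x : C2) = ρ • y}

/-! ### Fourier parametrizations -/

/-- Real trigonometric polynomials. -/
def IsTrigPolynomial (F : ℝ → ℝ) : Prop :=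
  ∃ (N : ℕ) (a : ℤ → ℂ), (∀ l, a (-l) = conj (a l)) ∧
    ∀ t : ℝ, (F t : ℂ) = ∑ l ∈ Finset.Icc (-(N : ℤ)) N, a l * Complex.exp (Complex.I * l * t)

/-- The data of a Fourier parametrization with `s` strands: for each link component `C` the number
`len C = s_C` of its strands, two real trigonometric polynomials `F_C`, `G_C`, and a numbering of the
`s = ∑ s_C` curves. -/
structure FourierData (s : ℕ) where
  numComponents : ℕ
  len : Fin numComponents → ℕ
  len_pos : ∀ C, 0 < len C
  label : Fin s ≃ Σ C : Fin numComponents, Fin (len C)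
  F : Fin numComponents → ℝ → ℝ
  G : Fin numComponents → ℝ → ℝ
  trig_F : ∀ C, IsTrigPolynomial (F C)
  trig_G : ∀ C, IsTrigPolynomial (G C)

namespace FourierData

variable {s : ℕ} (D : FourierData s)

/-- `F_C((t + 2πj)/s_C) + i G_C((t + 2πj)/s_C)`; the index `j ∈ {1, …, s_C}` is written as `j + 1`
with `j ∈ {0, …, s_C - 1}`. -/
def root (C : Fin D.numComponents) (j : Fin (D.len C)) (t : ℝ) : ℂ :=
  (D.F C ((t + 2 * Real.pi * ((j : ℝ) + 1)) / D.len C) : ℂ) +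
    Complex.I * (D.G C ((t + 2 * Real.pi * ((j : ℝ) + 1)) / D.len C) : ℂ)

/-- The curves of `D` form a geometric braid, and this braid is isotopic to `B`.  (The curve
`(C, j)` ends where `(C, j + 1)` starts, so the components of the closure of `B` correspond to the
indices `C`, the component of index `C` having `s_C` strands.) -/
def Parametrizes (B : GeometricBraid s) : Prop :=
  ∃ Q : GeometricBraid s,
    (∀ i, ∀ t ∈ Set.Icc (0 : ℝ) (2 * Real.pi),
      Q.strand i t = D.root (D.label i).1 (D.label i).2 t) ∧
    GeometricBraid.Isotopic B Q

/-- The polynomial `g_a(u, e^{it})` in `u`, as a (`2π`-periodic) function of `t`. -/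
def g (a t : ℝ) : Polynomial ℂ :=
  ∏ C, ∏ j, (Polynomial.X - Polynomial.C ((a : ℂ) * D.root C j t))

/-- The value `ψ₀(e^{it}, e^{-it})`, as a (`2π`-periodic) function of `t`. -/
def psi₀ (a t : ℝ) : ℂ := (a : ℂ) ^ s * ∏ C, ∏ j, D.root C j t

/-- `P` is the mixed polynomial
`p_{a,k}(u, v, v̄) = (v v̄)^{sk} g_a(u / (v v̄)^k, v / √(v v̄))`, a polynomial in `u, v, v̄`.
The formula, valid for `v ≠ 0`, determines `P`. -/
def IsP (a : ℝ) (k : ℕ) (P : MixedPolynomial) : Prop :=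
  Sum.inr 0 ∉ P.vars ∧
    ∀ (u v : ℂ) (t : ℝ), v ≠ 0 → v / ‖v‖ = Complex.exp (t * Complex.I) →
      P.toFun !₂[u, v] = (v * conj v) ^ (s * k) * (D.g a t).eval (u / (v * conj v) ^ k)

end FourierData

end

/-!
The statement follows once the strands of `B` are represented by functions `h_j(2t)`, where the
`h_j` are exponential polynomials `∑ c_x e^{ixt}` with real frequencies `x` that the translation by
`2π` permutes, without zeros, pairwise different at all times, and such that at every time the
polynomial with the roots `h_j(t)` has only simple critical points.

*Construction of the roots.* Let `B` be isotopic to `w²`.  The strands of `w`, extended to the real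
line by the permutation of `w`, are approximated by exponential polynomials with the same
permutation (`exists_equivariant_approx`).  The discriminant of the derivative of `∏ (u - z_j)` is a
polynomial in the roots `z_j`; for roots `f_j(t) + e η_j(t)` it is a polynomial in `e`, depending
smoothly on the one real parameter `t`.  It is not the zero polynomial as soon as the roots `η_j(t)`
have simple critical points, and then the values `e` at which it vanishes for some `t` have empty
interior: simple roots move along curves, and roots of higher order are simple roots of a derivative
(`dense_ne_root_of_family`).  So a small generic `e` makes all critical points simple, at all times.
Suitable `η_j` are real functions at most two of which agree at any time, since a real polynomial
with real roots that are at most double has simple critical points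
(`exists_equivariant_at_most_double`, `hasSimpleCriticalPoints_of_real`).  A large translation then
moves all roots away from `0`.  Close braids are isotopic (`GeometricBraid.isotopic_of_close`), so
the braid run through twice is isotopic to `w²`.

*Critical values.* Since they are simple, the critical points are smooth functions of `t` on the
whole line (`exists_contDiff_roots`), hence so are the critical values; these do not vanish because
the roots are different.

*The mixed polynomial.* The coefficients of the polynomial with the roots `h_j(t)` are `2π`-periodic
exponential polynomials, thus trigonometric polynomials; at double speed they only contain even
frequencies.  This is where the square is needed: `|v|^{2n} e^{2il arg v} = v^{n+l} v̄^{n-l}` is a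
polynomial for `|l| ≤ n` (`exists_mixedPolynomial_eq_prod`).

*The link.* On the axis `v = 0` the mixed polynomial is `u^s`, and elsewhere it is the product of the
factors `u - a|v|^{2k} h_j(2 arg v)`, which has simple zeros in `u`.  Its zeros in a sphere are
carried to the closure of the braid by ambient isotopies (`isWeakRealization_of_eq_prod`): one that
rescales `u / |v|` (`ambientIsotopic_weighted_curveCone`), and one that follows the isotopy of braids
(`GeometricBraid.Isotopic.ambientIsotopic`).  For both, a family of braids is cut into small steps,
and a small step is realized by the map `(u, v) ↦ (u + displacement, v)` on `ℂ²`, where the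
displacement is Lipschitz in `u` with a constant less than `1`, followed by the projection to the
sphere (`ambientIsotopic_curveCone_of_close`).
-/

/-! ### Ambient isotopies of spheres -/

namespace AmbientIsotopic

variable {X : Type*} [TopologicalSpace X] {K L M : Set X}

theorem trans (h : AmbientIsotopic K L) (h' : AmbientIsotopic L M) : AmbientIsotopic K M := by
  obtain ⟨H, hH, h0, h1⟩ := h
  obtain ⟨H', hH', h0', h1'⟩ := h'
  refine ⟨fun τ => (H τ).trans (H' τ), ?_, fun x => by simp [h0, h0'], ?_⟩
  · exact hH'.comp (continuous_fst.prodMk hH)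
  · rw [← h1', ← h1, Set.image_image]
    rfl

theorem refl (K : Set X) : AmbientIsotopic K K :=
  ⟨fun _ => Homeomorph.refl X, continuous_snd, fun _ => rfl, by simp⟩

theorem symm (h : AmbientIsotopic K L) : AmbientIsotopic L K := by
  obtain ⟨H, hH, h0, h1⟩ := h
  refine ⟨fun τ => (H 1).symm.trans (H (unitInterval.symm τ)), ?_, fun x => by simp, ?_⟩
  · exact hH.comp ((unitInterval.continuous_symm.comp continuous_fst).prodMk
      ((H 1).symm.continuous.comp continuous_snd))
  · rw [← h1, Set.image_image]
    simp [h0]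

end AmbientIsotopic

/-- Positively homogeneous bijections `A τ` of a Euclidean space induce homeomorphisms
`x ↦ ρ A(x) / ‖A(x)‖` of the sphere of radius `ρ`, hence an ambient isotopy there. -/
theorem ambientIsotopic_sphere_of_homogeneous {E : Type*} [NormedAddCommGroup E]
    [NormedSpace ℝ E] [ProperSpace E] {A : unitInterval → E → E}
    (hA : Continuous fun p : unitInterval × E => A p.1 p.2)
    (hbij : ∀ τ, Function.Bijective (A τ))
    (hhom : ∀ τ (r : ℝ) x, 0 < r → A τ (r • x) = r • A τ x) (h0 : ∀ x, A 0 x = x)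
    {K L : Set E} (hL : ∀ (r : ℝ) x, 0 < r → (r • x ∈ L ↔ x ∈ L))
    (hKL : ∀ x, A 1 x ∈ L ↔ x ∈ K) {ρ : ℝ} (hρ : 0 < ρ) :
    AmbientIsotopic {x : Metric.sphere (0 : E) ρ | (x : E) ∈ K}
      {x : Metric.sphere (0 : E) ρ | (x : E) ∈ L} := by
  have hA0 : ∀ τ, A τ 0 = 0 := fun τ => by
    have h := hhom τ 2 0 two_pos
    rw [smul_zero, two_smul] at h
    exact left_eq_add.1 h
  have hne : ∀ τ (x : Metric.sphere (0 : E) ρ), A τ x ≠ 0 := fun τ x hx => by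
    have h1 : (x : E) = 0 := (hbij τ).1 (hx.trans (hA0 τ).symm)
    have h2 := mem_sphere_zero_iff_norm.1 x.2
    rw [h1, norm_zero] at h2
    exact hρ.ne h2
  have hpos : ∀ τ (x : Metric.sphere (0 : E) ρ), 0 < ρ / ‖A τ x‖ := fun τ x =>
    div_pos hρ (norm_pos_iff.2 (hne τ x))
  let f : unitInterval → Metric.sphere (0 : E) ρ → Metric.sphere (0 : E) ρ := fun τ x =>
    ⟨(ρ / ‖A τ x‖) • A τ x, by
      rw [mem_sphere_zero_iff_norm, norm_smul, Real.norm_of_nonneg (hpos τ x).le,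
        div_mul_cancel₀ _ (norm_ne_zero_iff.2 (hne τ x))]⟩
  have hf : Continuous fun p : unitInterval × Metric.sphere (0 : E) ρ => f p.1 p.2 := by
    have h1 : Continuous fun p : unitInterval × Metric.sphere (0 : E) ρ => A p.1 p.2 :=
      hA.comp (continuous_fst.prodMk (continuous_subtype_val.comp continuous_snd))
    refine Continuous.subtype_mk ?_ _
    exact (continuous_const.div h1.norm fun p => norm_ne_zero_iff.2 (hne p.1 p.2)).smul h1
  have hinj : ∀ τ, Function.Injective (f τ) := fun τ x y hxy => by
    have h1 : (ρ / ‖A τ x‖) • A τ x = (ρ / ‖A τ y‖) • A τ y := congrArg Subtype.val hxy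
    rw [← hhom _ _ _ (hpos τ x), ← hhom _ _ _ (hpos τ y)] at h1
    have h2 := (hbij τ).1 h1
    have h3 := congrArg norm h2
    rw [norm_smul, norm_smul, mem_sphere_zero_iff_norm.1 x.2, mem_sphere_zero_iff_norm.1 y.2,
      Real.norm_of_nonneg (hpos τ x).le, Real.norm_of_nonneg (hpos τ y).le] at h3
    rw [mul_right_cancel₀ hρ.ne' h3] at h2
    exact Subtype.ext (smul_right_injective E (hpos τ y).ne' h2)
  have hsurj : ∀ τ, Function.Surjective (f τ) := fun τ y => by
    obtain ⟨x, hx⟩ := (hbij τ).2 y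
    have hy := mem_sphere_zero_iff_norm.1 y.2
    have hx0 : 0 < ‖x‖ := norm_pos_iff.2 fun h => by
      rw [h, hA0] at hx
      rw [← hx, norm_zero] at hy
      exact hρ.ne hy
    have hr : 0 < ρ / ‖x‖ := div_pos hρ hx0
    refine ⟨⟨(ρ / ‖x‖) • x, ?_⟩, ?_⟩
    · rw [mem_sphere_zero_iff_norm, norm_smul, Real.norm_of_nonneg hr.le,
        div_mul_cancel₀ _ hx0.ne']
    · refine Subtype.ext ?_
      change (ρ / ‖A τ ((ρ / ‖x‖) • x)‖) • A τ ((ρ / ‖x‖) • x) = y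
      rw [hhom _ _ _ hr, hx, norm_smul, hy, Real.norm_of_nonneg hr.le, smul_smul]
      rw [show ρ / (ρ / ‖x‖ * ρ) * (ρ / ‖x‖) = 1 by field_simp, one_smul]
  refine ⟨fun τ => Continuous.homeoOfEquivCompactToT2
    (f := Equiv.ofBijective (f τ) ⟨hinj τ, hsurj τ⟩)
    (hf.comp (continuous_const.prodMk continuous_id)), hf, fun x => ?_, ?_⟩
  · refine Subtype.ext ?_
    change (ρ / ‖A 0 x‖) • A 0 x = (x : E)
    rw [h0, mem_sphere_zero_iff_norm.1 x.2, div_self hρ.ne', one_smul]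
  · have key : ∀ x, f 1 x ∈ {x : Metric.sphere (0 : E) ρ | (x : E) ∈ L} ↔
        x ∈ {x : Metric.sphere (0 : E) ρ | (x : E) ∈ K} := fun x => by
      change (ρ / ‖A 1 x‖) • A 1 (x : E) ∈ L ↔ (x : E) ∈ K
      rw [hL _ _ (hpos 1 x), hKL]
    ext y
    constructor
    · rintro ⟨x, hx, rfl⟩
      exact (key x).2 hx
    · intro hy
      obtain ⟨x, rfl⟩ := hsurj 1 y
      exact ⟨x, (key x).1 hy, rfl⟩

/-! ### Closed braids as cones in `ℂ²` -/

/-- The cone over the closed multi-curve `{(γ_j(t), e^{it})} ⊆ ℂ × S¹`, without its vertex. -/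
def curveCone {ι : Type*} (γ : ι → ℝ → ℂ) : Set C2 :=
  {x | x 1 ≠ 0 ∧ ∃ j, ∃ t ∈ Set.Icc (0 : ℝ) (2 * Real.pi),
    x 1 = ‖x 1‖ * Complex.exp (t * Complex.I) ∧ x 0 = ‖x 1‖ * γ j t}

theorem smul_mem_curveCone {ι : Type*} (γ : ι → ℝ → ℂ) (r : ℝ) (x : C2) (hr : 0 < r) :
    r • x ∈ curveCone γ ↔ x ∈ curveCone γ := by
  have hr' : (r : ℂ) ≠ 0 := by exact_mod_cast hr.ne'
  simp only [curveCone, Set.mem_ofPred_eq, PiLp.smul_apply, norm_mul, Complex.norm_real,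
    Real.norm_of_nonneg hr.le, Complex.real_smul, Complex.ofReal_mul, mul_assoc,
    mul_right_inj' hr', ne_eq, mul_eq_zero, hr', false_or]

theorem curveCone_congr {ι : Type*} {γ γ' : ι → ℝ → ℂ}
    (h : ∀ j, ∀ t ∈ Set.Icc (0 : ℝ) (2 * Real.pi), γ j t = γ' j t) :
    curveCone γ = curveCone γ' := by
  ext x
  refine and_congr_right fun _ => exists_congr fun j => exists_congr fun t =>
    and_congr_right fun ht => ?_
  rw [h j t ht]

/-- A map `id + contraction` of a Banach space is bijective. -/
theorem bijective_add_of_lipschitz {E : Type*} [NormedAddCommGroup E] [CompleteSpace E]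
    {f : E → E} {K : NNReal} (hK : K < 1) (hf : LipschitzWith K f) :
    Function.Bijective fun x => x + f x := by
  constructor
  · intro x y hxy
    have h1 : x - y = f y - f x := by
      have : x + f x = y + f y := hxy
      rw [sub_eq_sub_iff_add_eq_add, this, add_comm]
    have h2 := hf.dist_le_mul y x
    rw [dist_eq_norm, ← h1, dist_eq_norm, norm_sub_rev y x] at h2
    have h3 : (K : ℝ) < 1 := by exact_mod_cast hK
    have h4 : ‖x - y‖ = 0 := by nlinarith [norm_nonneg (x - y)]
    exact sub_eq_zero.1 (norm_eq_zero.1 h4)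
  · intro y
    have hc : ContractingWith K fun x => y - f x :=
      ⟨hK, LipschitzWith.of_dist_le_mul fun a b => by
        rw [dist_sub_left]; exact hf.dist_le_mul a b⟩
    refine ⟨hc.fixedPoint, ?_⟩
    have h := hc.fixedPoint_isFixedPt
    have h' : y - f hc.fixedPoint = hc.fixedPoint := h
    change hc.fixedPoint + f hc.fixedPoint = y
    exact (sub_eq_iff_eq_add.1 h').symm

/-- A bounded continuous function on `ℂ × ℝ/ℤ` extends, homogeneously of degree one, to a
continuous function on `ℂ²` that vanishes on `v = 0`. -/
theorem continuous_norm_smul_comp_arg {F : ℂ → ℝ → ℂ}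
    (hF : Continuous fun p : ℂ × ℝ => F p.1 p.2) (hper : ∀ z x (n : ℤ), F z (x + n) = F z x)
    {M : ℝ} (hM : ∀ z x, ‖F z x‖ ≤ M) :
    Continuous fun p : ℂ × ℂ => (‖p.2‖ : ℂ) * F (p.1 / ‖p.2‖) (p.2.arg / (2 * Real.pi)) := by
  rw [continuous_iff_continuousAt]
  rintro ⟨u, v⟩
  rcases eq_or_ne v 0 with rfl | hv
  · rw [ContinuousAt]
    simp only [norm_zero, Complex.ofReal_zero, zero_mul]
    refine squeeze_zero_norm (a := fun p : ℂ × ℂ => ‖p.2‖ * M) (fun p => ?_) ?_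
    · rw [norm_mul, Complex.norm_real, norm_norm]
      exact mul_le_mul_of_nonneg_left (hM _ _) (norm_nonneg _)
    · have : Continuous fun p : ℂ × ℂ => ‖p.2‖ * M := by fun_prop
      simpa using this.tendsto (u, 0)
  · have hv' : ((‖v‖ : ℝ) : ℂ) ≠ 0 := by simpa using hv
    -- near `v`, a continuous branch of the argument is `w ↦ arg (w / v) + arg v`
    have h1 : ContinuousAt (fun p : ℂ × ℂ =>
        (‖p.2‖ : ℂ) * F (p.1 / ‖p.2‖) (((p.2 / v).arg + v.arg) / (2 * Real.pi))) (u, v) := by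
      have h2 : ContinuousAt (fun p : ℂ × ℂ => (p.2 / v).arg) (u, v) := by
        have h3 : ContinuousAt (fun p : ℂ × ℂ => p.2 / v) (u, v) := by fun_prop
        refine ContinuousAt.comp (g := Complex.arg) (f := fun p : ℂ × ℂ => p.2 / v) ?_ h3
        simp only [div_self hv]
        exact Complex.continuousAt_arg (by simp)
      have h4 : ContinuousAt (fun p : ℂ × ℂ => ((‖p.2‖ : ℝ) : ℂ)) (u, v) := by fun_prop
      refine h4.mul ?_
      refine ContinuousAt.comp (g := fun p : ℂ × ℝ => F p.1 p.2)
        (f := fun p : ℂ × ℂ => (p.1 / (‖p.2‖ : ℂ), ((p.2 / v).arg + v.arg) / (2 * Real.pi)))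
        hF.continuousAt ?_
      exact ContinuousAt.prodMk (continuousAt_fst.div h4 hv')
        ((h2.add continuousAt_const).div_const _)
    refine h1.congr ?_
    have hne : ∀ᶠ p : ℂ × ℂ in 𝓝 (u, v), p.2 ≠ 0 :=
      continuousAt_snd.eventually_ne hv
    filter_upwards [hne] with p hp
    have h5 : (((p.2 / v).arg + v.arg : ℝ) : Real.Angle) = (p.2.arg : ℝ) := by
      have := Complex.arg_mul_coe_angle (div_ne_zero hp hv) hv
      rw [div_mul_cancel₀ _ hv] at this
      rw [this, Real.Angle.coe_add]
    obtain ⟨n, hn⟩ := Real.Angle.angle_eq_iff_two_pi_dvd_sub.1 h5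
    have h6 : ((p.2 / v).arg + v.arg) / (2 * Real.pi) = p.2.arg / (2 * Real.pi) + n := by
      rw [sub_eq_iff_eq_add.1 hn]
      field_simp
      ring
    rw [h6, hper]

/-! ### Pushing the strands of a closed braid -/

/-- The displacement that pushes each `c j` to `c' j` and fades out linearly with the distance from
`c j`, up to the distance `δ`. -/
noncomputable def pushField {ι : Type*} [Fintype ι] (δ : ℝ) (c c' : ι → ℂ) (z : ℂ) : ℂ :=
  ∑ j, ((max 0 (1 - ‖z - c j‖ / δ) : ℝ) : ℂ) * (c' j - c j)

section pushField

variable {ι : Type*} [Fintype ι] {δ d : ℝ} {c c' : ι → ℂ}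

theorem norm_pushField_le (hδ : 0 < δ) (hd : ∀ j, ‖c' j - c j‖ ≤ d) (z : ℂ) :
    ‖pushField δ c c' z‖ ≤ Fintype.card ι * d := by
  refine (norm_sum_le _ _).trans ?_
  rw [← nsmul_eq_mul, ← Finset.card_univ]
  refine Finset.sum_le_card_nsmul _ _ _ fun j _ => ?_
  rw [norm_mul, Complex.norm_real, Real.norm_of_nonneg (le_max_left _ _)]
  have h1 : max 0 (1 - ‖z - c j‖ / δ) ≤ 1 :=
    max_le zero_le_one (by have := div_nonneg (norm_nonneg (z - c j)) hδ.le; linarith)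
  calc _ ≤ 1 * ‖c' j - c j‖ := mul_le_mul_of_nonneg_right h1 (norm_nonneg _)
    _ ≤ d := by rw [one_mul]; exact hd j

theorem pushField_self [DecidableEq ι] (hδ : 0 < δ) (hsep : ∀ i j, i ≠ j → δ ≤ ‖c i - c j‖)
    (j : ι) : pushField δ c c' (c j) = c' j - c j := by
  rw [pushField, Finset.sum_eq_single j]
  · simp
  · intro i _ hij
    have h1 : 1 ≤ ‖c j - c i‖ / δ := (one_le_div hδ).2 (hsep j i hij.symm)
    rw [max_eq_left (by linarith)]
    simp
  · simp

theorem norm_pushField_sub_le (hδ : 0 < δ) (hd : ∀ j, ‖c' j - c j‖ ≤ d) (z w : ℂ) :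
    ‖pushField δ c c' z - pushField δ c c' w‖ ≤ Fintype.card ι * d / δ * ‖z - w‖ := by
  rw [pushField, pushField, ← Finset.sum_sub_distrib]
  refine (norm_sum_le _ _).trans ?_
  have h : ∀ j ∈ (Finset.univ : Finset ι), ‖((max 0 (1 - ‖z - c j‖ / δ) : ℝ) : ℂ) * (c' j - c j) -
      ((max 0 (1 - ‖w - c j‖ / δ) : ℝ) : ℂ) * (c' j - c j)‖ ≤ d / δ * ‖z - w‖ := fun j _ => by
    rw [← sub_mul, norm_mul, ← Complex.ofReal_sub, Complex.norm_real, Real.norm_eq_abs]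
    have h1 : |max 0 (1 - ‖z - c j‖ / δ) - max 0 (1 - ‖w - c j‖ / δ)| ≤ ‖z - w‖ / δ := by
      refine (abs_max_sub_max_le_max _ _ _ _).trans ?_
      rw [sub_self, abs_zero, max_eq_right (abs_nonneg _)]
      rw [show 1 - ‖z - c j‖ / δ - (1 - ‖w - c j‖ / δ) = (‖w - c j‖ - ‖z - c j‖) / δ by ring,
        abs_div, abs_of_pos hδ]
      refine div_le_div_of_nonneg_right ?_ hδ.le
      refine (abs_norm_sub_norm_le _ _).trans ?_
      rw [sub_sub_sub_cancel_right, norm_sub_rev]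
    calc _ ≤ ‖z - w‖ / δ * d := mul_le_mul h1 (hd j) (norm_nonneg _) (by positivity)
      _ = _ := by ring
  refine (Finset.sum_le_card_nsmul _ _ _ h).trans (le_of_eq ?_)
  rw [Finset.card_univ, nsmul_eq_mul]
  ring

theorem pushField_perm (σ : Equiv.Perm ι) (z : ℂ) :
    pushField δ (fun j => c (σ j)) (fun j => c' (σ j)) z = pushField δ c c' z :=
  Equiv.sum_comp σ fun j => ((max 0 (1 - ‖z - c j‖ / δ) : ℝ) : ℂ) * (c' j - c j)

end pushField

/-- The angle `t ∈ [0, 2π]` of a point of the circle is determined up to `0 ~ 2π`. -/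
theorem fract_arg_eq {v : ℂ} (hv : v ≠ 0) {t : ℝ} (ht : t ∈ Set.Icc (0 : ℝ) (2 * Real.pi))
    (h : v = ‖v‖ * Complex.exp (t * Complex.I)) :
    2 * Real.pi * Int.fract (v.arg / (2 * Real.pi)) = t ∨
      2 * Real.pi * Int.fract (v.arg / (2 * Real.pi)) = 0 ∧ t = 2 * Real.pi := by
  have hpi := Real.two_pi_pos
  have h1 : (v.arg : Real.Angle) = (t : ℝ) := by
    conv_lhs => rw [h]
    exact Complex.arg_mul_cos_add_sin_mul_I_coe_angle (norm_pos_iff.2 hv) t ▸ by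
      rw [Complex.exp_mul_I, Real.Angle.cos_coe, Real.Angle.sin_coe, Complex.ofReal_cos,
        Complex.ofReal_sin]
  obtain ⟨n, hn⟩ := Real.Angle.angle_eq_iff_two_pi_dvd_sub.1 h1
  have h2 : v.arg / (2 * Real.pi) = t / (2 * Real.pi) + n := by
    rw [sub_eq_iff_eq_add.1 hn]
    field_simp
    ring
  rw [h2, Int.fract_add_intCast]
  rcases eq_or_lt_of_le ht.2 with rfl | hlt
  · right
    simp
  · left
    rw [Int.fract_eq_self.2 ⟨div_nonneg ht.1 hpi.le, (div_lt_one hpi).2 hlt⟩]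
    field_simp

/-- Two closed multi-curves that are close, compared with the distances between the strands of the
first one, are ambient isotopic: push the strands in the fibres `v = const`. -/
theorem ambientIsotopic_curveCone_of_close {ι : Type*} [Fintype ι] {γ γ' : ι → ℝ → ℂ}
    (hγ : ∀ j, ContinuousOn (γ j) (Set.Icc 0 (2 * Real.pi)))
    (hγ' : ∀ j, ContinuousOn (γ' j) (Set.Icc 0 (2 * Real.pi))) {σ : Equiv.Perm ι}
    (hσ : ∀ j, γ (σ j) 0 = γ j (2 * Real.pi)) (hσ' : ∀ j, γ' (σ j) 0 = γ' j (2 * Real.pi))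
    {δ d : ℝ} (hδ : 0 < δ)
    (hsep : ∀ t ∈ Set.Icc (0 : ℝ) (2 * Real.pi), ∀ i j, i ≠ j → δ ≤ ‖γ i t - γ j t‖)
    (hd : ∀ t ∈ Set.Icc (0 : ℝ) (2 * Real.pi), ∀ j, ‖γ' j t - γ j t‖ ≤ d)
    (hdδ : Fintype.card ι * d / δ < 1) {ρ : ℝ} (hρ : 0 < ρ) :
    AmbientIsotopic {x : Metric.sphere (0 : C2) ρ | (x : C2) ∈ curveCone γ}
      {x : Metric.sphere (0 : C2) ρ | (x : C2) ∈ curveCone γ'} := by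
  classical
  have hpi := Real.two_pi_pos
  -- `z = u / |v|` and `x`, the angle of `v` divided by `2π`, are the coordinates off the axis `v = 0`
  let D : ℂ → ℝ → ℂ := fun z x =>
    pushField δ (fun j => γ j (2 * Real.pi * x)) (fun j => γ' j (2 * Real.pi * x)) z
  let F : ℂ → ℝ → ℂ := fun z x => D z (Int.fract x)
  have hmem : ∀ {x : ℝ}, x ∈ Set.Icc (0 : ℝ) 1 → 2 * Real.pi * x ∈ Set.Icc 0 (2 * Real.pi) :=
    fun {x} hx => ⟨mul_nonneg hpi.le hx.1, mul_le_of_le_one_right hpi.le hx.2⟩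
  have hfr : ∀ x : ℝ, 2 * Real.pi * Int.fract x ∈ Set.Icc 0 (2 * Real.pi) := fun x =>
    hmem ⟨Int.fract_nonneg x, (Int.fract_lt_one x).le⟩
  -- the strands close up, so the displacement is a function on the circle
  have hD01 : ∀ z, D z 0 = D z 1 := fun z => by
    simp only [D, mul_zero, mul_one, ← hσ, ← hσ']
    exact (pushField_perm (c := fun j => γ j 0) (c' := fun j => γ' j 0) σ z).symm
  have hFc : Continuous fun p : ℂ × ℝ => F p.1 p.2 := by
    refine ContinuousOn.comp_fract' ?_ hD01
    have hc : ∀ {η : ℝ → ℂ}, ContinuousOn η (Set.Icc 0 (2 * Real.pi)) →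
        ContinuousOn (fun p : ℂ × ℝ => η (2 * Real.pi * p.2)) (Set.univ ×ˢ Set.Icc 0 1) :=
      fun h => h.comp (by fun_prop) fun p hp => hmem hp.2
    refine continuousOn_finsetSum _ fun j _ => ?_
    refine (Complex.continuous_ofReal.comp_continuousOn ?_).mul ((hc (hγ' j)).sub (hc (hγ j)))
    exact (continuous_const.max continuous_id).comp_continuousOn (continuousOn_const.sub
      ((continuousOn_fst.sub (hc (hγ j))).norm.div_const _))
  have hFper : ∀ z x (n : ℤ), F z (x + n) = F z x := fun z x n => by
    simp only [F, Int.fract_add_intCast]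
  have hFM : ∀ z x, ‖F z x‖ ≤ Fintype.card ι * d := fun z x =>
    norm_pushField_le hδ (hd _ (hfr x)) z
  -- the displacement of `u`, homogeneous of degree one in `(u, v)`
  let G : ℂ → ℂ → ℂ := fun u v => (‖v‖ : ℂ) * F (u / ‖v‖) (v.arg / (2 * Real.pi))
  have hGc : Continuous fun p : ℂ × ℂ => G p.1 p.2 :=
    continuous_norm_smul_comp_arg hFc hFper hFM
  have hGF : ∀ {v : ℂ}, v ≠ 0 → ∀ {t : ℝ}, t ∈ Set.Icc (0 : ℝ) (2 * Real.pi) →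
      v = ‖v‖ * Complex.exp (t * Complex.I) → ∀ j,
      G (‖v‖ * γ j t) v = ‖v‖ * (γ' j t - γ j t) := fun {v} hv {t} ht h j => by
    have hv' : ((‖v‖ : ℝ) : ℂ) ≠ 0 := by simpa using hv
    have h1 : F (γ j t) (v.arg / (2 * Real.pi)) = D (γ j t) (t / (2 * Real.pi)) := by
      rcases fract_arg_eq hv ht h with h2 | ⟨h2, rfl⟩
      · simp only [F]
        rw [← h2]
        congr 1
        field_simp
      · have h3 : Int.fract (v.arg / (2 * Real.pi)) = 0 := by
          simpa [Real.pi_ne_zero] using h2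
        simp only [F]
        rw [h3, hD01, div_self hpi.ne']
    simp only [G]
    rw [mul_div_cancel_left₀ _ hv', h1]
    simp only [D]
    rw [mul_div_cancel₀ _ hpi.ne']
    congr 1
    exact pushField_self (c := fun j => γ j t) hδ (hsep t ht) j
  have hd0 : 0 ≤ Fintype.card ι * d := (norm_nonneg _).trans (hFM 0 0)
  set k : NNReal := ⟨Fintype.card ι * d / δ, div_nonneg hd0 hδ.le⟩ with hk
  have hk1 : k < 1 := by
    rw [← NNReal.coe_lt_coe]
    exact hdδ
  have hGlip : ∀ v (τ : unitInterval), LipschitzWith k fun u => (τ : ℂ) * G u v := fun v τ => by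
    refine LipschitzWith.of_dist_le_mul fun u w => ?_
    rw [dist_eq_norm, dist_eq_norm, ← mul_sub, norm_mul]
    have hτ : ‖((τ : ℝ) : ℂ)‖ ≤ 1 := by
      rw [Complex.norm_real, Real.norm_of_nonneg τ.2.1]
      exact τ.2.2
    refine (mul_le_of_le_one_left (norm_nonneg _) hτ).trans ?_
    rcases eq_or_ne v 0 with rfl | hv
    · simp only [G, norm_zero, Complex.ofReal_zero, zero_mul, sub_zero]
      positivity
    · simp only [G]
      rw [← mul_sub, norm_mul, Complex.norm_real, norm_norm]
      have h1 := norm_pushField_sub_le hδ (hd _ (hfr (v.arg / (2 * Real.pi))))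
        (u / ‖v‖) (w / ‖v‖)
      refine (mul_le_mul_of_nonneg_left h1 (norm_nonneg v)).trans (le_of_eq ?_)
      rw [← sub_div, norm_div, Complex.norm_real, norm_norm]
      have := norm_ne_zero_iff.2 hv
      change _ = Fintype.card ι * d / δ * _
      field_simp
  let A : unitInterval → C2 → C2 := fun τ x => !₂[x 0 + (τ : ℂ) * G (x 0) (x 1), x 1]
  have hinj : ∀ τ, Function.Injective (A τ) := fun τ x y hxy => by
    have h1 : x 1 = y 1 := congrFun (congrArg WithLp.ofLp hxy) 1
    have h0 : x 0 + (τ : ℂ) * G (x 0) (x 1) = y 0 + (τ : ℂ) * G (y 0) (y 1) :=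
      congrFun (congrArg WithLp.ofLp hxy) 0
    rw [h1] at h0
    have h2 := (bijective_add_of_lipschitz hk1 (hGlip (y 1) τ)).1 h0
    ext i
    fin_cases i
    · exact h2
    · exact h1
  refine ambientIsotopic_sphere_of_homogeneous (A := A) ?_ ?_ ?_ ?_ (smul_mem_curveCone γ') ?_ hρ
  · have hx0 : Continuous fun p : unitInterval × C2 => p.2 0 := by fun_prop
    have hx1 : Continuous fun p : unitInterval × C2 => p.2 1 := by fun_prop
    have hτ : Continuous fun p : unitInterval × C2 => ((p.1 : ℝ) : ℂ) := by fun_prop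
    have hc : Continuous fun p : unitInterval × C2 =>
        p.2 0 + ((p.1 : ℝ) : ℂ) * G (p.2 0) (p.2 1) :=
      hx0.add (hτ.mul (hGc.comp (hx0.prodMk hx1)))
    refine (PiLp.continuous_toLp 2 _).comp (continuous_pi fun i => ?_)
    fin_cases i
    · exact hc
    · exact hx1
  · refine fun τ => ⟨hinj τ, fun y => ?_⟩
    obtain ⟨u, hu⟩ := (bijective_add_of_lipschitz hk1 (hGlip (y 1) τ)).2 (y 0)
    refine ⟨!₂[u, y 1], ?_⟩
    ext i
    fin_cases i
    · exact hu
    · rfl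
  · intro τ r x hr
    have hr' : (r : ℂ) ≠ 0 := by exact_mod_cast hr.ne'
    have hG : G (r * x 0) (r * x 1) = r * G (x 0) (x 1) := by
      simp only [G]
      rw [norm_mul, Complex.norm_real, Real.norm_of_nonneg hr.le, Complex.ofReal_mul,
        mul_div_mul_left _ _ hr', Complex.arg_real_mul _ hr, mul_assoc]
    ext i
    fin_cases i
    · change (r : ℂ) * x 0 + τ * G (r * x 0) (r * x 1) = r * (x 0 + τ * G (x 0) (x 1))
      rw [hG]
      ring
    · rfl
  · intro x
    ext i
    fin_cases i
    · change x 0 + ((0 : ℝ) : ℂ) * _ = x 0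
      simp
    · rfl
  · have hA1 : ∀ x : C2, A 1 x = !₂[x 0 + G (x 0) (x 1), x 1] := fun x => by
      simp [A]
    intro x
    constructor
    · rintro ⟨hv, j, t, ht, h1, h0⟩
      have hv : x 1 ≠ 0 := hv
      have h1 : x 1 = ‖x 1‖ * Complex.exp (t * Complex.I) := h1
      have h2 : A 1 x = A 1 !₂[‖x 1‖ * γ j t, x 1] := by
        ext i
        fin_cases i
        · rw [hA1 !₂[‖x 1‖ * γ j t, x 1]]
          change A 1 x 0 = ‖x 1‖ * γ j t + G (‖x 1‖ * γ j t) (x 1)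
          rw [hGF hv ht h1, ← mul_add, add_sub_cancel]
          exact h0
        · rfl
      refine ⟨hv, j, t, ht, h1, ?_⟩
      exact congrFun (congrArg WithLp.ofLp (hinj 1 h2)) 0
    · rintro ⟨hv, j, t, ht, h1, h0⟩
      refine ⟨hv, j, t, ht, h1, ?_⟩
      rw [hA1]
      change x 0 + G (x 0) (x 1) = ‖x 1‖ * γ' j t
      rw [h0, hGF hv ht h1, ← mul_add, add_sub_cancel]

/-- Isotopy extension: a continuous family of closed multi-curves is induced by an ambient isotopy.
By compactness the family is a chain of steps that are small compared with the distances between the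
strands. -/
theorem ambientIsotopic_curveCone_of_family {ι : Type*} [Fintype ι] {Γ : ℝ → ι → ℝ → ℂ}
    (hΓ : ∀ j, ContinuousOn (fun x : ℝ × ℝ => Γ x.1 j x.2)
      (Set.Icc 0 1 ×ˢ Set.Icc 0 (2 * Real.pi)))
    (hclose : ∀ τ ∈ Set.Icc (0 : ℝ) 1, ∃ σ : Equiv.Perm ι,
      ∀ j, Γ τ (σ j) 0 = Γ τ j (2 * Real.pi))
    (hinj : ∀ τ ∈ Set.Icc (0 : ℝ) 1, ∀ t ∈ Set.Icc (0 : ℝ) (2 * Real.pi),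
      Function.Injective fun j => Γ τ j t) {ρ : ℝ} (hρ : 0 < ρ) :
    AmbientIsotopic {x : Metric.sphere (0 : C2) ρ | (x : C2) ∈ curveCone (Γ 0)}
      {x : Metric.sphere (0 : C2) ρ | (x : C2) ∈ curveCone (Γ 1)} := by
  set S : Set (ℝ × ℝ) := Set.Icc 0 1 ×ˢ Set.Icc 0 (2 * Real.pi) with hS
  have hSc : IsCompact S := isCompact_Icc.prod isCompact_Icc
  have hpi := Real.two_pi_pos
  -- a lower bound for the distances between the strands
  obtain ⟨δ, hδ, hsep⟩ : ∃ δ : ℝ, 0 < δ ∧ ∀ i j, i ≠ j → ∀ x ∈ S,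
      δ ≤ ‖Γ x.1 i x.2 - Γ x.1 j x.2‖ := by
    have h1 : ∀ᶠ δ in 𝓝[>] (0 : ℝ), ∀ i j, i ≠ j → ∀ x ∈ S,
        δ ≤ ‖Γ x.1 i x.2 - Γ x.1 j x.2‖ := by
      refine Filter.eventually_all.2 fun i => Filter.eventually_all.2 fun j => ?_
      by_cases hij : i = j
      · exact Filter.Eventually.of_forall fun _ h => absurd hij h
      obtain ⟨x₀, hx₀, hmin⟩ := hSc.exists_isMinOn
        ⟨(0, 0), by simp [hS, Real.pi_pos.le]⟩ ((hΓ i).sub (hΓ j)).norm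
      have hpos : 0 < ‖Γ x₀.1 i x₀.2 - Γ x₀.1 j x₀.2‖ := by
        refine norm_pos_iff.2 (sub_ne_zero.2 fun h => hij ?_)
        exact hinj _ hx₀.1 _ hx₀.2 h
      filter_upwards [Ioo_mem_nhdsGT hpos] with δ hδ _ x hx
      exact hδ.2.le.trans (hmin hx)
    obtain ⟨δ, h, hδ⟩ := (h1.and self_mem_nhdsWithin).exists
    exact ⟨δ, hδ, h⟩
  -- the size of the steps
  obtain ⟨d, hd, hdδ, hd2⟩ : ∃ d : ℝ, 0 < d ∧ Fintype.card ι * d / δ < 1 ∧ d + d < δ := by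
    refine ⟨δ / (2 * (Fintype.card ι + 2)), by positivity, ?_, ?_⟩
    · rw [div_lt_one hδ, mul_div_assoc', div_lt_iff₀ (by positivity)]
      nlinarith
    · rw [← two_mul, mul_div_assoc', div_lt_iff₀ (by positivity)]
      have : (0 : ℝ) ≤ Fintype.card ι := by positivity
      nlinarith
  obtain ⟨η, hη, hunif⟩ : ∃ η : ℝ, 0 < η ∧ ∀ x ∈ S, ∀ y ∈ S, dist x y < η → ∀ j,
      ‖Γ x.1 j x.2 - Γ y.1 j y.2‖ < d := by
    have hc : ContinuousOn (fun x : ℝ × ℝ => fun j => Γ x.1 j x.2) S := continuousOn_pi.2 hΓ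
    obtain ⟨η, hη, h⟩ := Metric.uniformContinuousOn_iff.1
      (hSc.uniformContinuousOn_of_continuous hc) d hd
    refine ⟨η, hη, fun x hx y hy hxy j => ?_⟩
    rw [← dist_eq_norm]
    exact (dist_pi_lt_iff hd).1 (h x hx y hy hxy) j
  obtain ⟨n, hn⟩ := exists_nat_one_div_lt hη
  have hn0 : (0 : ℝ) < n + 1 := by positivity
  have hmemS : ∀ {m : ℕ}, m ≤ n + 1 → (m : ℝ) / (n + 1) ∈ Set.Icc (0 : ℝ) 1 := fun {m} hm =>
    ⟨by positivity, (div_le_one hn0).2 (by exact_mod_cast hm)⟩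
  have key : ∀ m : ℕ, m ≤ n + 1 →
      AmbientIsotopic {x : Metric.sphere (0 : C2) ρ | (x : C2) ∈ curveCone (Γ 0)}
      {x : Metric.sphere (0 : C2) ρ | (x : C2) ∈ curveCone (Γ (m / (n + 1)))} := by
    intro m
    induction m with
    | zero =>
      intro _
      simpa using AmbientIsotopic.refl _
    | succ m ih =>
      intro hm
      refine (ih (by omega)).trans ?_
      have h0 := hmemS (m := m) (by omega)
      have h1 := hmemS hm
      set τ : ℝ := m / (n + 1) with hτ
      set τ' : ℝ := ((m + 1 : ℕ) : ℝ) / (n + 1) with hτ'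
      have hdist : ∀ t ∈ Set.Icc (0 : ℝ) (2 * Real.pi), ∀ j, ‖Γ τ' j t - Γ τ j t‖ < d := by
        intro t ht j
        refine hunif (τ', t) ⟨h1, ht⟩ (τ, t) ⟨h0, ht⟩ ?_ j
        rw [Prod.dist_eq, dist_self, Real.dist_eq, hτ, hτ', ← sub_div]
        push_cast
        rw [add_sub_cancel_left, abs_of_pos (by positivity)]
        exact max_lt hn hη
      obtain ⟨σ, hσ⟩ := hclose τ h0
      obtain ⟨σ', hσ'⟩ := hclose τ' h1
      have hz : (0 : ℝ) ∈ Set.Icc (0 : ℝ) (2 * Real.pi) := ⟨le_rfl, hpi.le⟩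
      have hp : 2 * Real.pi ∈ Set.Icc (0 : ℝ) (2 * Real.pi) := ⟨hpi.le, le_rfl⟩
      -- the permutation of the strands does not change in a small step
      have hσσ' : ∀ j, σ' j = σ j := fun j => by
        by_contra hne
        have h2 := hsep _ _ hne (τ', 0) ⟨h1, hz⟩
        have h3 := hdist _ hp j
        have h4 := hdist 0 hz (σ j)
        have h5 : Γ τ' (σ' j) 0 - Γ τ' (σ j) 0 = (Γ τ' j (2 * Real.pi) - Γ τ j (2 * Real.pi)) -
            (Γ τ' (σ j) 0 - Γ τ (σ j) 0) := by
          rw [hσ', hσ]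
          ring
        simp only [h5] at h2
        linarith [norm_sub_le (Γ τ' j (2 * Real.pi) - Γ τ j (2 * Real.pi))
          (Γ τ' (σ j) 0 - Γ τ (σ j) 0)]
      have hcont : ∀ {a : ℝ}, a ∈ Set.Icc (0 : ℝ) 1 → ∀ j,
          ContinuousOn (Γ a j) (Set.Icc 0 (2 * Real.pi)) := fun {a} ha j =>
        (hΓ j).comp (f := fun t => (a, t)) (by fun_prop) fun t ht => ⟨ha, ht⟩
      exact ambientIsotopic_curveCone_of_close (hcont h0) (hcont h1) hσ
        (fun j => by rw [← hσσ' j]; exact hσ' j) hδ (fun t ht i j hij => hsep i j hij (τ, t) ⟨h0, ht⟩)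
        (fun t ht j => (hdist t ht j).le) hdδ hρ
  have h := key (n + 1) le_rfl
  rwa [Nat.cast_add, Nat.cast_one, div_self hn0.ne'] at h

/-! ### Braid isotopies -/

namespace GeometricBraid

variable {s : ℕ}

/-- The scaled closure of a braid is the section of a cone by a sphere. -/
theorem mem_smul_closure_iff (B : GeometricBraid s) {ρ : ℝ} (hρ : 0 < ρ)
    (x : Metric.sphere (0 : C2) ρ) :
    (∃ y ∈ B.closure, (x : C2) = ρ • y) ↔ (x : C2) ∈ curveCone B.strand := by
  have hpos : ∀ j t, 0 < Real.sqrt (1 + ‖B.strand j t‖ ^ 2) := fun j t =>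
    Real.sqrt_pos.2 (by positivity)
  constructor
  · rintro ⟨y, ⟨j, t, ht, hy⟩, hx⟩
    have hr := div_pos hρ (hpos j t)
    have h1 : (x : C2) = (ρ / Real.sqrt (1 + ‖B.strand j t‖ ^ 2)) •
        (!₂[B.strand j t, Complex.exp (t * Complex.I)] : C2) := by
      rw [hx, hy]
      ext i
      simp only [PiLp.smul_apply, Complex.real_smul, smul_eq_mul]
      push_cast
      ring
    rw [h1, smul_mem_curveCone _ _ _ hr]
    refine ⟨Complex.exp_ne_zero _, j, t, ht, ?_, ?_⟩ <;> simp [Complex.norm_exp_ofReal_mul_I]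
  · rintro ⟨hv, j, t, ht, h1, h0⟩
    refine ⟨_, ⟨j, t, ht, rfl⟩, ?_⟩
    have hn : ‖(x : C2)‖ ^ 2 = ‖(x : C2) 0‖ ^ 2 + ‖(x : C2) 1‖ ^ 2 := by
      rw [EuclideanSpace.norm_sq_eq, Fin.sum_univ_two]
    have h2 : ‖(x : C2) 0‖ = ‖(x : C2) 1‖ * ‖B.strand j t‖ := by
      rw [h0, norm_mul, Complex.norm_real, norm_norm]
    have h3 : ρ = ‖(x : C2) 1‖ * Real.sqrt (1 + ‖B.strand j t‖ ^ 2) := by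
      rw [mem_sphere_zero_iff_norm.1 x.2, h2] at hn
      have h4 : ρ ^ 2 = (‖(x : C2) 1‖ * Real.sqrt (1 + ‖B.strand j t‖ ^ 2)) ^ 2 := by
        rw [mul_pow, Real.sq_sqrt (by positivity), hn]
        ring
      exact (sq_eq_sq₀ hρ.le (mul_nonneg (norm_nonneg _) (hpos j t).le)).1 h4
    have h5 : (ρ : ℂ) * ((Real.sqrt (1 + ‖B.strand j t‖ ^ 2) : ℂ))⁻¹ = ‖(x : C2) 1‖ := by
      have h6 : ((Real.sqrt (1 + ‖B.strand j t‖ ^ 2) : ℝ) : ℂ) ≠ 0 := by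
        exact_mod_cast (hpos j t).ne'
      conv_lhs => rw [h3]
      push_cast
      rw [mul_assoc, mul_inv_cancel₀ h6, mul_one]
    ext i
    fin_cases i
    · change (x : C2) 0 = ρ * (((Real.sqrt (1 + ‖B.strand j t‖ ^ 2) : ℂ))⁻¹ * B.strand j t)
      rw [← mul_assoc, h5, ← h0]
    · change (x : C2) 1 = ρ * (((Real.sqrt (1 + ‖B.strand j t‖ ^ 2) : ℂ))⁻¹ *
        Complex.exp (t * Complex.I))
      rw [← mul_assoc, h5, ← h1]

theorem Isotopic.ambientIsotopic {B B' : GeometricBraid s} (h : Isotopic B B') {ρ : ℝ}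
    (hρ : 0 < ρ) :
    AmbientIsotopic {x : Metric.sphere (0 : C2) ρ | (x : C2) ∈ curveCone B.strand}
      {x : Metric.sphere (0 : C2) ρ | (x : C2) ∈ curveCone B'.strand} := by
  obtain ⟨H, hH, h0, h1⟩ := h
  rw [← curveCone_congr h0, ← curveCone_congr h1]
  exact ambientIsotopic_curveCone_of_family (Γ := fun τ => (H τ).strand) hH
    (fun τ _ => ⟨(H τ).perm, (H τ).closes⟩) (fun τ _ t ht => (H τ).disjoint t ht) hρ

/-- Concatenation of isotopies. -/
theorem Isotopic.trans {B B' B'' : GeometricBraid s} (h : Isotopic B B') (h' : Isotopic B' B'') :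
    Isotopic B B'' := by
  obtain ⟨H, hH, h0, h1⟩ := h
  obtain ⟨H', hH', h0', h1'⟩ := h'
  refine ⟨fun τ => if τ ≤ 1 / 2 then H (2 * τ) else H' (2 * τ - 1), fun j => ?_, fun j t ht => ?_,
    fun j t ht => ?_⟩
  · have hS : Set.Icc (0 : ℝ) 1 ×ˢ Set.Icc (0 : ℝ) (2 * Real.pi) =
        (Set.Icc 0 (1 / 2) ×ˢ Set.Icc 0 (2 * Real.pi)) ∪
        (Set.Icc (1 / 2) 1 ×ˢ Set.Icc 0 (2 * Real.pi)) := by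
      rw [← Set.union_prod, Set.Icc_union_Icc_eq_Icc] <;> norm_num
    rw [hS]
    refine ContinuousOn.union_of_isClosed ?_ ?_ (isClosed_Icc.prod isClosed_Icc)
      (isClosed_Icc.prod isClosed_Icc)
    · refine ((hH j).comp (f := fun x : ℝ × ℝ => (2 * x.1, x.2)) (by fun_prop) ?_).congr ?_
      · rintro x ⟨hx, ht⟩
        exact ⟨⟨by linarith [hx.1], by linarith [hx.2]⟩, ht⟩
      · rintro x ⟨hx, ht⟩
        simp only [hx.2, if_true, Function.comp_apply]
    · refine ((hH' j).comp (f := fun x : ℝ × ℝ => (2 * x.1 - 1, x.2)) (by fun_prop) ?_).congr ?_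
      · rintro x ⟨hx, ht⟩
        exact ⟨⟨by linarith [hx.1], by linarith [hx.2]⟩, ht⟩
      · rintro ⟨τ, t⟩ ⟨hx, ht⟩
        rcases eq_or_lt_of_le hx.1 with h | h
        · simp only at h
          subst h
          norm_num
          rw [h1 j t ht, h0' j t ht]
        · simp only [not_le.2 h, if_false, Function.comp_apply]
  · norm_num
    exact h0 j t ht
  · norm_num
    exact h1' j t ht

/-- The straight-line homotopy between two braids with the same permutation is an isotopy if the
differences of the strands are close to each other. -/
theorem isotopic_of_close {B B' : GeometricBraid s} (hperm : B.perm = B'.perm)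
    (h : ∀ t ∈ Set.Icc (0 : ℝ) (2 * Real.pi), ∀ i j, i ≠ j →
      ‖(B'.strand i t - B'.strand j t) - (B.strand i t - B.strand j t)‖ <
        ‖B.strand i t - B.strand j t‖) : Isotopic B B' := by
  classical
  let f : ℝ → Fin s → ℝ → ℂ := fun τ j t =>
    B.strand j t + (τ : ℂ) * (B'.strand j t - B.strand j t)
  have hf : ∀ j, ContinuousOn (fun x : ℝ × ℝ => f x.1 j x.2)
      (Set.univ ×ˢ Set.Icc 0 (2 * Real.pi)) := fun j => by
    have h1 : ContinuousOn (fun x : ℝ × ℝ => B.strand j x.2)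
        (Set.univ ×ˢ Set.Icc 0 (2 * Real.pi)) :=
      (B.continuousOn j).comp continuousOn_snd fun x hx => hx.2
    have h2 : ContinuousOn (fun x : ℝ × ℝ => B'.strand j x.2)
        (Set.univ ×ˢ Set.Icc 0 (2 * Real.pi)) :=
      (B'.continuousOn j).comp continuousOn_snd fun x hx => hx.2
    have h3 : Continuous fun x : ℝ × ℝ => (x.1 : ℂ) := by fun_prop
    exact h1.add (h3.continuousOn.mul (h2.sub h1))
  let H : ℝ → GeometricBraid s := fun τ =>
    if hτ : τ ∈ Set.Icc (0 : ℝ) 1 then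
      { strand := f τ
        perm := B.perm
        continuousOn := fun j => (hf j).comp (f := fun t => (τ, t)) (by fun_prop)
          fun t ht => ⟨trivial, ht⟩
        disjoint := fun t ht i j hij => by
          by_contra hne
          have h1 := h t ht i j hne
          have h2 : B.strand i t - B.strand j t = -((τ : ℂ) *
              ((B'.strand i t - B'.strand j t) - (B.strand i t - B.strand j t))) := by
            have h3 : B.strand i t + (τ : ℂ) * (B'.strand i t - B.strand i t) =
              B.strand j t + (τ : ℂ) * (B'.strand j t - B.strand j t) := hij
            linear_combination h3
          have h4 := congrArg norm h2
          rw [norm_neg, norm_mul, Complex.norm_real, Real.norm_of_nonneg hτ.1] at h4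
          nlinarith [mul_le_of_le_one_left (norm_nonneg ((B'.strand i t - B'.strand j t) -
            (B.strand i t - B.strand j t))) hτ.2]
        ordered := fun i j hij => by
          have h1 := B.ordered hij
          have h2 := B'.ordered hij
          simp only [f, Complex.add_re, Complex.mul_re, Complex.ofReal_re, Complex.ofReal_im,
            Complex.sub_re, zero_mul, sub_zero] at h1 h2 ⊢
          rcases eq_or_lt_of_le hτ.1 with h0 | h0
          · rw [← h0]
            linarith
          · nlinarith [mul_pos h0 (sub_pos.2 h2), mul_nonneg (sub_nonneg.2 hτ.2)
              (sub_pos.2 h1).le]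
        closes := fun j => by
          simp only [f]
          rw [B.closes, hperm, B'.closes] }
    else B
  have hH : ∀ τ ∈ Set.Icc (0 : ℝ) 1, (H τ).strand = f τ := fun τ hτ => by
    simp only [H, dif_pos hτ]
  refine ⟨H, fun j => ?_, fun j t _ => ?_, fun j t _ => ?_⟩
  · refine ((hf j).mono (Set.prod_mono_left (Set.subset_univ _))).congr ?_
    rintro x ⟨hx, -⟩
    simp only [hH _ hx]
  · rw [hH 0 ⟨le_rfl, zero_le_one⟩]
    simp [f]
  · rw [hH 1 ⟨zero_le_one, le_rfl⟩]
    simp [f]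

end GeometricBraid

/-! ### The radial rescaling of the zero set -/

/-- The radial homeomorphism `z ↦ c (1 + |z|²)^{n/2} z` of `ℂ` has the inverse `w ↦ ν(|w|) w`. -/
theorem exists_radial_inverse {c : ℝ} (hc : 0 < c) (n : ℕ) :
    ∃ ν : ℝ → ℝ, Continuous ν ∧ (∀ R, 0 < ν R) ∧ StrictMono (fun R => R * ν R) ∧
      ∀ z w : ℂ, z = ν ‖w‖ * w ↔ w = ((c * Real.sqrt (1 + ‖z‖ ^ 2) ^ n : ℝ) : ℂ) * z := by
  let φ : ℝ → ℝ := fun x => c * Real.sqrt (1 + x ^ 2) ^ n * x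
  have hs1 : ∀ x : ℝ, 1 ≤ Real.sqrt (1 + x ^ 2) := fun x =>
    Real.one_le_sqrt.2 (by nlinarith [sq_nonneg x])
  have hm : ∀ x : ℝ, c ≤ c * Real.sqrt (1 + x ^ 2) ^ n := fun x =>
    le_mul_of_one_le_right hc.le (one_le_pow₀ (hs1 x))
  have hmpos : ∀ x : ℝ, 0 < c * Real.sqrt (1 + x ^ 2) ^ n := fun x => hc.trans_le (hm x)
  have hφmono : StrictMono φ := by
    refine strictMono_of_odd_strictMonoOn_nonneg (fun x => by simp [φ]) ?_
    intro x hx y hy hxy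
    have hx : 0 ≤ x := hx
    have h1 : c * Real.sqrt (1 + x ^ 2) ^ n ≤ c * Real.sqrt (1 + y ^ 2) ^ n := by gcongr
    exact mul_lt_mul' h1 hxy hx (hmpos y)
  have hφc : Continuous φ := by fun_prop
  have hφsurj : Function.Surjective φ := by
    refine hφc.surjective ?_ ?_
    · refine Filter.tendsto_atTop_mono' _ ?_ (Filter.tendsto_id.const_mul_atTop hc)
      filter_upwards [Filter.eventually_ge_atTop 0] with x hx
      exact mul_le_mul_of_nonneg_right (hm x) hx
    · refine Filter.tendsto_atBot_mono' _ ?_ (Filter.tendsto_id.const_mul_atBot hc)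
      filter_upwards [Filter.eventually_le_atBot 0] with x hx
      exact mul_le_mul_of_nonpos_right (hm x) hx
  let e : ℝ ≃o ℝ := hφmono.orderIsoOfSurjective φ hφsurj
  have he : ∀ R, φ (e.symm R) = R := fun R => e.apply_symm_apply R
  have he' : ∀ x, e.symm (φ x) = x := fun x => e.symm_apply_apply x
  let ν : ℝ → ℝ := fun R => (c * Real.sqrt (1 + e.symm R ^ 2) ^ n)⁻¹
  have hν : ∀ R, R * ν R = e.symm R := fun R => by
    have h := he R
    simp only [φ] at h
    simp only [ν]
    rw [← div_eq_mul_inv, div_eq_iff (hmpos _).ne', mul_comm, h]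
  have hνpos : ∀ R, 0 < ν R := fun R => inv_pos.2 (hmpos _)
  refine ⟨ν, ?_, hνpos, ?_, fun z w => ?_⟩
  · have h1 : Continuous e.symm := e.symm.continuous
    have h2 : Continuous fun R => c * Real.sqrt (1 + e.symm R ^ 2) ^ n := by fun_prop
    exact h2.inv₀ fun R => (hmpos _).ne'
  · simpa only [hν] using e.symm.strictMono
  · constructor
    · intro h
      have h1 : ‖z‖ = e.symm ‖w‖ := by
        rw [h, norm_mul, Complex.norm_real, Real.norm_of_nonneg (hνpos _).le, mul_comm, hν]
      rw [h1, h, ← mul_assoc, ← Complex.ofReal_mul, mul_inv_cancel₀ (hmpos _).ne',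
        Complex.ofReal_one, one_mul]
    · intro h
      have h1 : e.symm ‖w‖ = ‖z‖ := by
        rw [h, norm_mul, Complex.norm_real, Real.norm_of_nonneg (hmpos _).le]
        exact he' ‖z‖
      have h2 : ν ‖w‖ = (c * Real.sqrt (1 + ‖z‖ ^ 2) ^ n)⁻¹ := by simp only [ν, h1]
      rw [h2]
      conv_rhs => rw [h]
      rw [← mul_assoc, ← Complex.ofReal_mul, inv_mul_cancel₀ (hmpos _).ne',
        Complex.ofReal_one, one_mul]

/-- On a sphere, the set `u = a |v|^{n+1} γ_j(t)`, `v = |v| e^{it}`, is ambient isotopic to the cone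
over `γ`: the two differ by a radial homeomorphism in the coordinate `u / |v|`. -/
theorem ambientIsotopic_weighted_curveCone {ι : Type*} [Fintype ι] {γ : ι → ℝ → ℂ}
    (hγ : ∀ j, ContinuousOn (γ j) (Set.Icc 0 (2 * Real.pi)))
    (hclose : ∃ σ : Equiv.Perm ι, ∀ j, γ (σ j) 0 = γ j (2 * Real.pi))
    (hinj : ∀ t ∈ Set.Icc (0 : ℝ) (2 * Real.pi), Function.Injective fun j => γ j t)
    {a : ℝ} (ha : 0 < a) (n : ℕ) {ρ : ℝ} (hρ : 0 < ρ) :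
    AmbientIsotopic
      {x : Metric.sphere (0 : C2) ρ | (x : C2) 1 ≠ 0 ∧ ∃ j, ∃ t ∈ Set.Icc (0 : ℝ) (2 * Real.pi),
        (x : C2) 1 = ‖(x : C2) 1‖ * Complex.exp (t * Complex.I) ∧
        (x : C2) 0 = a * (‖(x : C2) 1‖ : ℂ) ^ (n + 1) * γ j t}
      {x : Metric.sphere (0 : C2) ρ | (x : C2) ∈ curveCone γ} := by
  obtain ⟨ν, hνc, hνpos, hνmono, hν⟩ :=
    exists_radial_inverse (c := (a * ρ ^ n)⁻¹) (by positivity) n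
  let Γ : ℝ → ι → ℝ → ℂ := fun τ j t => (((1 - τ) + τ * ν ‖γ j t‖ : ℝ) : ℂ) * γ j t
  have hpos : ∀ τ ∈ Set.Icc (0 : ℝ) 1, ∀ R, 0 < (1 - τ) + τ * ν R := fun τ hτ R => by
    rcases eq_or_lt_of_le hτ.1 with h0 | h0
    · rw [← h0]
      norm_num
    · have := mul_pos h0 (hνpos R)
      linarith [hτ.2]
  have hmono : ∀ τ ∈ Set.Icc (0 : ℝ) 1, StrictMono fun R => ((1 - τ) + τ * ν R) * R :=
    fun τ hτ x y hxy => by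
      have h1 := hνmono hxy
      simp only at h1 ⊢
      rcases eq_or_lt_of_le hτ.1 with h0 | h0
      · rw [← h0]
        linarith
      · nlinarith [mul_pos h0 (sub_pos.2 h1), mul_nonneg (sub_nonneg.2 hτ.2) (sub_pos.2 hxy).le]
  -- the straight-line homotopy from `γ` to `ν(|γ|) γ`; it is radially increasing at each stage
  have key := ambientIsotopic_curveCone_of_family (Γ := Γ) (fun j => ?_) (fun τ _ => ?_)
    (fun τ hτ t ht i j hij => ?_) hρ
  · have h0 : Γ 0 = γ := by
      ext j t
      simp [Γ]
    rw [h0] at key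
    refine AmbientIsotopic.symm ?_
    convert key using 1
    ext x
    refine and_congr_right fun hv => exists_congr fun j => exists_congr fun t =>
      and_congr_right fun ht => and_congr_right fun _ => ?_
    have hv : (x : C2) 1 ≠ 0 := hv
    set z : ℂ := (x : C2) 0 / ‖(x : C2) 1‖ with hz
    have hr : 0 < ‖(x : C2) 1‖ := norm_pos_iff.2 hv
    have hr' : ((‖(x : C2) 1‖ : ℝ) : ℂ) ≠ 0 := by exact_mod_cast hr.ne'
    have hx0 : (x : C2) 0 = ‖(x : C2) 1‖ * z := (mul_div_cancel₀ _ hr').symm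
    have hs : 0 < Real.sqrt (1 + ‖z‖ ^ 2) := Real.sqrt_pos.2 (by positivity)
    have hn : ‖(x : C2)‖ ^ 2 = ‖(x : C2) 0‖ ^ 2 + ‖(x : C2) 1‖ ^ 2 := by
      rw [EuclideanSpace.norm_sq_eq, Fin.sum_univ_two]
    -- on the sphere, `|v|` is a function of `|z|`
    have hρ' : ρ = ‖(x : C2) 1‖ * Real.sqrt (1 + ‖z‖ ^ 2) := by
      rw [mem_sphere_zero_iff_norm.1 x.2, hx0, norm_mul, Complex.norm_real, norm_norm] at hn
      have h4 : ρ ^ 2 = (‖(x : C2) 1‖ * Real.sqrt (1 + ‖z‖ ^ 2)) ^ 2 := by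
        rw [mul_pow, Real.sq_sqrt (by positivity), hn]
        ring
      exact (sq_eq_sq₀ hρ.le (mul_pos hr hs).le).1 h4
    have h1 : (a * ρ ^ n)⁻¹ * Real.sqrt (1 + ‖z‖ ^ 2) ^ n = (a * ‖(x : C2) 1‖ ^ n)⁻¹ := by
      conv_lhs => rw [hρ', mul_pow]
      field_simp
    have h2 := hν z (γ j t)
    rw [h1] at h2
    have h3 : ((a * ‖(x : C2) 1‖ ^ n : ℝ) : ℂ) ≠ 0 := by
      exact_mod_cast (mul_pos ha (pow_pos hr n)).ne'
    have h4 : (x : C2) 0 = a * (‖(x : C2) 1‖ : ℂ) ^ (n + 1) * γ j t ↔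
        γ j t = (((a * ‖(x : C2) 1‖ ^ n)⁻¹ : ℝ) : ℂ) * z := by
      rw [hx0, pow_succ, Complex.ofReal_inv, eq_inv_mul_iff_mul_eq₀ h3, mul_comm _ z,
        show (a : ℂ) * ((‖(x : C2) 1‖ : ℂ) ^ n * ‖(x : C2) 1‖) * γ j t =
          ((a * ‖(x : C2) 1‖ ^ n : ℝ) : ℂ) * γ j t * ‖(x : C2) 1‖ by push_cast; ring,
        mul_left_inj' hr']
      exact eq_comm
    have h5 : (x : C2) 0 = ‖(x : C2) 1‖ * Γ 1 j t ↔ z = ν ‖γ j t‖ * γ j t := by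
      rw [hx0, mul_right_inj' hr']
      simp [Γ]
    rw [h4, h5, h2]
  · have h1 : ContinuousOn (fun x : ℝ × ℝ => γ j x.2)
        (Set.Icc 0 1 ×ˢ Set.Icc 0 (2 * Real.pi)) :=
      (hγ j).comp continuousOn_snd fun x hx => hx.2
    have h2 : ContinuousOn (fun x : ℝ × ℝ => (1 - x.1) + x.1 * ν ‖γ j x.2‖)
        (Set.Icc 0 1 ×ˢ Set.Icc 0 (2 * Real.pi)) :=
      (continuousOn_const.sub continuousOn_fst).add
        (continuousOn_fst.mul (hνc.comp_continuousOn h1.norm))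
    exact (Complex.continuous_ofReal.comp_continuousOn h2).mul h1
  · obtain ⟨σ, hσ⟩ := hclose
    exact ⟨σ, fun j => by simp only [Γ, hσ]⟩
  · refine hinj t ht ?_
    have hij : Γ τ i t = Γ τ j t := hij
    simp only [Γ] at hij
    have h1 := congrArg norm hij
    rw [norm_mul, norm_mul, Complex.norm_real, Complex.norm_real,
      Real.norm_of_nonneg (hpos τ hτ _).le, Real.norm_of_nonneg (hpos τ hτ _).le] at h1
    have h2 : ‖γ i t‖ = ‖γ j t‖ := (hmono τ hτ).injective h1
    rw [h2] at hij
    exact mul_left_cancel₀ (by exact_mod_cast (hpos τ hτ _).ne') hij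

/-! ### Exponential polynomials -/

/-- The function `t ↦ e^{ixt}` with real frequency `x`. -/
noncomputable def expFun (x : ℝ) : ℝ → ℂ := fun t => Complex.exp (Complex.I * x * t)

/-- The algebra of exponential polynomials: complex linear combinations of the functions `e^{ixt}`
with arbitrary real frequencies `x`. -/
noncomputable def expPoly : Subalgebra ℂ (ℝ → ℂ) :=
  (Submodule.span ℂ (Set.range expFun)).toSubalgebra
    (Submodule.subset_span ⟨0, by ext; simp [expFun]⟩)
    (fun f g hf hg => by
      have h := Submodule.mul_mem_mul hf hg
      rw [Submodule.span_mul_span] at h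
      refine Submodule.span_mono ?_ h
      rintro _ ⟨_, ⟨x, rfl⟩, _, ⟨y, rfl⟩, rfl⟩
      refine ⟨x + y, ?_⟩
      ext t
      simp only [expFun, Pi.mul_apply, ← Complex.exp_add]
      congr 1
      push_cast
      ring)

theorem mem_expPoly {f : ℝ → ℂ} : f ∈ expPoly ↔ f ∈ Submodule.span ℂ (Set.range expFun) := Iff.rfl

theorem expFun_mem (x : ℝ) : expFun x ∈ expPoly := mem_expPoly.2 (Submodule.subset_span ⟨x, rfl⟩)

theorem const_mem_expPoly (c : ℂ) : (fun _ => c) ∈ expPoly := expPoly.algebraMap_mem c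

theorem expPoly_induction {p : (ℝ → ℂ) → Prop} (hexp : ∀ x, p (expFun x))
    (hadd : ∀ f g, p f → p g → p (f + g)) (hsmul : ∀ (c : ℂ) f, p f → p (c • f))
    {f : ℝ → ℂ} (hf : f ∈ expPoly) : p f := by
  refine Submodule.span_induction (p := fun f _ => p f) ?_ ?_ (fun f g _ _ => hadd f g)
    (fun c f _ => hsmul c f) (mem_expPoly.1 hf)
  · rintro _ ⟨x, rfl⟩
    exact hexp x
  · simpa using hsmul 0 _ (hexp 0)

theorem comp_affine_mem_expPoly (q r : ℝ) {f : ℝ → ℂ} (hf : f ∈ expPoly) :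
    (fun t => f (q * t + r)) ∈ expPoly := by
  refine expPoly_induction (p := fun f => (fun t => f (q * t + r)) ∈ expPoly) (fun x => ?_)
    (fun f g hf hg => expPoly.add_mem hf hg) (fun c f hf => expPoly.smul_mem hf c) hf
  have h : (fun t => expFun x (q * t + r)) =
      Complex.exp (Complex.I * x * r) • expFun (x * q) := by
    ext t
    simp only [expFun, Pi.smul_apply, smul_eq_mul, ← Complex.exp_add]
    congr 1
    push_cast
    ring
  rw [h]
  exact expPoly.smul_mem (expFun_mem _) _

theorem cos_mem_expPoly (q r : ℝ) : (fun t : ℝ => ((Real.cos (q * t + r) : ℝ) : ℂ)) ∈ expPoly := by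
  have h : (fun t : ℝ => ((Real.cos (q * t + r) : ℝ) : ℂ)) = fun t =>
      ((1 / 2 : ℂ) • (expFun 1 + expFun (-1))) (q * t + r) := by
    ext t
    simp only [Complex.ofReal_cos, Complex.cos, expFun, Pi.smul_apply, Pi.add_apply, smul_eq_mul]
    push_cast
    rw [mul_one, mul_comm Complex.I, mul_neg, mul_one, neg_mul, neg_mul, mul_comm Complex.I]
    ring
  rw [h]
  exact comp_affine_mem_expPoly q r
    (expPoly.smul_mem (expPoly.add_mem (expFun_mem 1) (expFun_mem (-1))) _)

theorem contDiff_of_mem_expPoly {f : ℝ → ℂ} (hf : f ∈ expPoly) : ContDiff ℝ ∞ f := by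
  refine expPoly_induction (p := fun f => ContDiff ℝ ∞ f) (fun x => ?_)
    (fun f g hf hg => hf.add hg) (fun c f hf => contDiff_const.smul hf) hf
  have h : ContDiff ℝ ∞ fun t : ℝ => (t : ℂ) := Complex.ofRealCLM.contDiff
  exact (contDiff_const.mul h).cexp

/-- The frequencies of a `2π`-periodic exponential polynomial are integers, since distinct
characters are linearly independent. -/
theorem exists_fourier_of_periodic {f : ℝ → ℂ} (hf : f ∈ expPoly)
    (hper : ∀ t, f (t + 2 * Real.pi) = f t) :
    ∃ (N : ℕ) (c : ℤ → ℂ), ∀ t : ℝ,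
      f t = ∑ l ∈ Finset.Icc (-(N : ℤ)) N, c l * Complex.exp (Complex.I * l * t) := by
  classical
  obtain ⟨a, ha⟩ := (Finsupp.mem_span_range_iff_exists_finsupp).1 (mem_expPoly.1 hf)
  let χ : ℝ → (Multiplicative ℝ →* ℂ) := fun x =>
    { toFun := fun t => expFun x t.toAdd
      map_one' := by simp [expFun]
      map_mul' := fun t u => by
        simp only [expFun, toAdd_mul, ← Complex.exp_add]
        congr 1
        push_cast
        ring }
  have hχ : Function.Injective χ := fun x y hxy => by
    have h1 : ∀ t : ℝ, expFun x t = expFun y t := fun t =>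
      DFunLike.congr_fun hxy (Multiplicative.ofAdd t)
    have h2 : ∀ z t : ℝ, HasDerivAt (expFun z) (Complex.exp (Complex.I * z * t) *
        (Complex.I * z * 1)) t := fun z t =>
      ((Complex.ofRealCLM.hasDerivAt (x := t)).const_mul (Complex.I * z)).cexp
    have h3 := (h2 x 0).unique ((funext h1 : expFun x = expFun y) ▸ h2 y 0)
    simpa using h3
  have hli := (linearIndependent_monoidHom (Multiplicative ℝ) ℂ).comp χ hχ
  have hrel : ∑ x ∈ a.support, (a x * (Complex.exp (Complex.I * x * (2 * Real.pi)) - 1)) •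
      ((fun f : Multiplicative ℝ →* ℂ => (f : Multiplicative ℝ → ℂ)) ∘ χ) x = 0 := by
    ext t
    have h1 := hper t.toAdd
    rw [← ha, Finsupp.sum, Finset.sum_apply, Finset.sum_apply, ← sub_eq_zero,
      ← Finset.sum_sub_distrib] at h1
    rw [Finset.sum_apply, Pi.zero_apply, ← h1]
    refine Finset.sum_congr rfl fun x _ => ?_
    have h2 : expFun x (t.toAdd + 2 * Real.pi) =
        expFun x t.toAdd * Complex.exp (Complex.I * x * (2 * Real.pi)) := by
      simp only [expFun, ← Complex.exp_add]
      congr 1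
      push_cast
      ring
    simp only [Pi.smul_apply, smul_eq_mul, h2]
    change _ * expFun x t.toAdd = _
    ring
  have hint : ∀ x ∈ a.support, ∃ n : ℤ, (n : ℝ) = x := fun x hx => by
    have h1 := linearIndependent_iff'.1 hli a.support _ hrel x hx
    have h2 := (mul_eq_zero.1 h1).resolve_left (Finsupp.mem_support_iff.1 hx)
    obtain ⟨n, hn⟩ := Complex.exp_eq_one_iff.1 (sub_eq_zero.1 h2)
    refine ⟨n, ?_⟩
    have h3 : (2 * Real.pi * Complex.I) * (x : ℂ) = (2 * Real.pi * Complex.I) * n := by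
      linear_combination hn
    have h4 := mul_left_cancel₀ Complex.two_pi_I_ne_zero h3
    exact_mod_cast h4.symm
  obtain ⟨N, hN⟩ : ∃ N : ℕ, ∀ x ∈ a.support, |x| ≤ N := by
    obtain ⟨N, hN⟩ := exists_nat_ge (∑ x ∈ a.support, |x|)
    exact ⟨N, fun x hx =>
      (Finset.single_le_sum (f := fun x : ℝ => |x|) (fun _ _ => abs_nonneg _) hx).trans hN⟩
  refine ⟨N, fun l => a l, fun t => ?_⟩
  rw [← ha, Finsupp.sum, Finset.sum_apply]
  have h1 : ∑ l ∈ Finset.Icc (-(N : ℤ)) N, a l * Complex.exp (Complex.I * l * t) =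
      ∑ x ∈ (Finset.Icc (-(N : ℤ)) N).image (fun l : ℤ => (l : ℝ)), a x * expFun x t := by
    rw [Finset.sum_image fun x _ y _ h => Int.cast_injective h]
    simp [expFun]
  rw [h1]
  refine Finset.sum_subset (fun x hx => ?_) fun x _ hx => ?_
  · obtain ⟨n, rfl⟩ := hint x hx
    have h2 := abs_le.1 (hN _ hx)
    refine Finset.mem_image.2 ⟨n, Finset.mem_Icc.2 ⟨?_, ?_⟩, rfl⟩
    · exact_mod_cast h2.1
    · exact_mod_cast h2.2
  · simp [Finsupp.notMem_support_iff.1 hx]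

theorem isTrigPolynomial_re {f : ℝ → ℂ} {N : ℕ} {c : ℤ → ℂ} (hf : ∀ t : ℝ,
      f t = ∑ l ∈ Finset.Icc (-(N : ℤ)) N, c l * Complex.exp (Complex.I * l * t)) :
    IsTrigPolynomial fun t => (f t).re := by
  refine ⟨N, fun l => (c l + conj (c (-l))) / 2, fun l => ?_, fun t => ?_⟩
  · simp only [neg_neg, map_div₀, map_add, Complex.conj_conj, map_ofNat]
    ring
  · have h1 : conj (f t) = ∑ l ∈ Finset.Icc (-(N : ℤ)) N,
        conj (c (-l)) * Complex.exp (Complex.I * l * t) := by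
      rw [hf, map_sum]
      refine Finset.sum_nbij' (fun l => -l) (fun l => -l) (fun l hl => ?_) (fun l hl => ?_)
        (fun l _ => neg_neg l) (fun l _ => neg_neg l) fun l _ => ?_
      · simp only [Finset.mem_Icc] at hl ⊢
        omega
      · simp only [Finset.mem_Icc] at hl ⊢
        omega
      · rw [map_mul, ← Complex.exp_conj, neg_neg]
        simp
    rw [Complex.re_eq_add_conj, h1, hf, ← Finset.sum_add_distrib, Finset.sum_div]
    refine Finset.sum_congr rfl fun l _ => ?_
    ring

theorem isTrigPolynomial_im {f : ℝ → ℂ} {N : ℕ} {c : ℤ → ℂ} (hf : ∀ t : ℝ,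
      f t = ∑ l ∈ Finset.Icc (-(N : ℤ)) N, c l * Complex.exp (Complex.I * l * t)) :
    IsTrigPolynomial fun t => (f t).im := by
  have h := isTrigPolynomial_re (f := fun t => -Complex.I * f t) (N := N)
    (c := fun l => -Complex.I * c l) fun t => by
      rw [hf, Finset.mul_sum]
      exact Finset.sum_congr rfl fun l _ => by ring
  simpa using h

/-! ### Equivariant approximation of the strands -/

/-- Weierstrass approximation of a periodic function by exponential polynomials. -/
theorem exists_expPoly_approx {Γ : ℝ → ℂ} (hΓ : Continuous Γ) {T : ℝ} (hT : 0 < T)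
    (hper : Function.Periodic Γ T) {ε : ℝ} (hε : 0 < ε) :
    ∃ p ∈ expPoly, Function.Periodic p T ∧ ∀ t, ‖p t - Γ t‖ < ε := by
  have : Fact (0 < T) := ⟨hT⟩
  let g : C(AddCircle T, ℂ) := ⟨hper.lift, continuous_coinduced_dom.2 hΓ⟩
  have hg : g ∈ (Submodule.span ℂ (Set.range (@fourier T))).topologicalClosure := by
    rw [span_fourier_closure_eq_top]
    trivial
  obtain ⟨q, hq, hgq⟩ := Metric.mem_closure_iff.1 hg ε hε
  refine ⟨fun t => q (t : AddCircle T), ?_, fun t => ?_, fun t => ?_⟩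
  · refine Submodule.span_induction (p := fun (q : C(AddCircle T, ℂ)) _ =>
      (fun t : ℝ => q (t : AddCircle T)) ∈ expPoly) ?_ ?_ ?_ ?_ hq
    · rintro _ ⟨n, rfl⟩
      convert expFun_mem (2 * Real.pi * n / T) using 1
      ext t
      rw [fourier_coe_apply, expFun]
      congr 1
      push_cast
      ring
    · exact expPoly.zero_mem
    · exact fun _ _ _ _ h h' => expPoly.add_mem h h'
    · exact fun c _ _ h => expPoly.smul_mem h c
  · simp only
    rw [AddCircle.coe_add, AddCircle.coe_period, add_zero]
  · rw [dist_comm, dist_eq_norm] at hgq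
    exact (ContinuousMap.norm_coe_le_norm (q - g) (t : AddCircle T)).trans_lt hgq

/-- Functions permuted by the translation by `2π` can be approximated by exponential polynomials
that are permuted in the same way: average over the translations. -/
theorem exists_equivariant_approx {ι : Type*} [Fintype ι] (σ : Equiv.Perm ι) {Γ : ι → ℝ → ℂ}
    (hΓ : ∀ j, Continuous (Γ j)) (hΓσ : ∀ j t, Γ j (t + 2 * Real.pi) = Γ (σ j) t)
    {ε : ℝ} (hε : 0 < ε) :
    ∃ f : ι → ℝ → ℂ, (∀ j, f j ∈ expPoly) ∧ (∀ j t, f j (t + 2 * Real.pi) = f (σ j) t) ∧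
      ∀ j t, ‖f j t - Γ j t‖ < ε := by
  set N := orderOf σ with hN
  have hN0 : 0 < N := orderOf_pos σ
  have hNC : (N : ℂ) ≠ 0 := by exact_mod_cast hN0.ne'
  have hiter : ∀ (m : ℕ) j t, Γ j (t + 2 * Real.pi * m) = Γ ((σ ^ m) j) t := by
    intro m
    induction m with
    | zero => simp
    | succ m ih =>
      intro j t
      rw [pow_succ, Equiv.Perm.mul_apply, ← ih, ← hΓσ]
      push_cast
      ring_nf
  have hT : 0 < 2 * Real.pi * N := mul_pos Real.two_pi_pos (by exact_mod_cast hN0)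
  have hper : ∀ j, Function.Periodic (Γ j) (2 * Real.pi * N) := fun j t => by
    rw [hiter, hN, pow_orderOf_eq_one, Equiv.Perm.one_apply]
  choose p hp hpper hpε using fun j => exists_expPoly_approx (hΓ j) hT (hper j) hε
  refine ⟨fun j t => (N : ℂ)⁻¹ * ∑ m ∈ Finset.range N, p ((σ ^ m) j) (t - 2 * Real.pi * m),
    fun j => ?_, fun j t => ?_, fun j t => ?_⟩
  · have h1 : (∑ m ∈ Finset.range N, fun t => p ((σ ^ m) j) (1 * t + -(2 * Real.pi * m))) ∈
        expPoly := expPoly.sum_mem fun m _ => comp_affine_mem_expPoly _ _ (hp _)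
    convert expPoly.smul_mem h1 ((N : ℂ)⁻¹) using 1
    ext t
    simp [Finset.sum_apply, sub_eq_add_neg]
  · let F : ℕ → ℂ := fun m => p ((σ ^ m) j) (t + 2 * Real.pi - 2 * Real.pi * m)
    have h1 : ∀ m : ℕ, p ((σ ^ m) (σ j)) (t - 2 * Real.pi * m) = F (m + 1) := fun m => by
      simp only [F]
      rw [pow_succ, Equiv.Perm.mul_apply]
      push_cast
      ring_nf
    simp only [h1]
    have h2 := Finset.sum_range_succ F N
    rw [Finset.sum_range_succ'] at h2
    have h3 : F N = F 0 := by
      simp only [F]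
      rw [hN, pow_orderOf_eq_one, ← hN, pow_zero, Nat.cast_zero, mul_zero, sub_zero]
      have := hpper j (t + 2 * Real.pi - 2 * Real.pi * N)
      rw [sub_add_cancel] at this
      exact this.symm
    rw [h3] at h2
    rw [add_right_cancel h2]
  · have h1 : (N : ℂ)⁻¹ * ∑ m ∈ Finset.range N, p ((σ ^ m) j) (t - 2 * Real.pi * m) - Γ j t =
        (N : ℂ)⁻¹ * ∑ m ∈ Finset.range N, (p ((σ ^ m) j) (t - 2 * Real.pi * m) - Γ j t) := by
      rw [Finset.sum_sub_distrib, Finset.sum_const, Finset.card_range, nsmul_eq_mul, mul_sub,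
        inv_mul_cancel_left₀ hNC]
    rw [h1, norm_mul, norm_inv, Complex.norm_natCast, inv_mul_lt_iff₀ (by exact_mod_cast hN0)]
    refine (norm_sum_le _ _).trans_lt ?_
    have h2 : ∀ m ∈ Finset.range N,
        ‖p ((σ ^ m) j) (t - 2 * Real.pi * m) - Γ j t‖ < ε := fun m _ => by
      have h3 := hpε ((σ ^ m) j) (t - 2 * Real.pi * m)
      rwa [← hiter, sub_add_cancel] at h3
    refine (Finset.sum_lt_sum_of_nonempty (Finset.nonempty_range_iff.2 hN0.ne') h2).trans_eq ?_
    rw [Finset.sum_const, Finset.card_range, nsmul_eq_mul]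

/-- The strands of a braid as functions on `ℝ`: run through the braid again and again. -/
noncomputable def GeometricBraid.extend {s : ℕ} (B : GeometricBraid s) (j : Fin s) (t : ℝ) : ℂ :=
  B.strand ((B.perm ^ ⌊t / (2 * Real.pi)⌋) j) (t - 2 * Real.pi * ⌊t / (2 * Real.pi)⌋)

namespace GeometricBraid

variable {s : ℕ} (B : GeometricBraid s)

theorem extend_add (j : Fin s) (t : ℝ) :
    B.extend j (t + 2 * Real.pi) = B.extend (B.perm j) t := by
  have h : (t + 2 * Real.pi) / (2 * Real.pi) = t / (2 * Real.pi) + 1 := by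
    field_simp
  rw [extend, extend, h, Int.floor_add_one, zpow_add_one, Equiv.Perm.mul_apply]
  push_cast
  ring_nf

theorem extend_eq (n : ℤ) (j : Fin s) {t : ℝ}
    (ht : t ∈ Set.Icc (2 * Real.pi * n) (2 * Real.pi * (n + 1))) :
    B.extend j t = B.strand ((B.perm ^ n) j) (t - 2 * Real.pi * n) := by
  have hpi := Real.two_pi_pos
  rcases eq_or_lt_of_le ht.2 with h | h
  · have h1 : ⌊t / (2 * Real.pi)⌋ = n + 1 := by
      rw [h, mul_div_cancel_left₀ _ hpi.ne', ← Int.cast_one, ← Int.cast_add, Int.floor_intCast]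
    rw [extend, h1, add_comm n 1, zpow_one_add, Equiv.Perm.mul_apply, h]
    push_cast
    rw [show 2 * Real.pi * ((n : ℝ) + 1) - 2 * Real.pi * (1 + n) = 0 by ring,
      show 2 * Real.pi * ((n : ℝ) + 1) - 2 * Real.pi * n = 2 * Real.pi by ring, B.closes]
  · have h1 : ⌊t / (2 * Real.pi)⌋ = n := by
      rw [Int.floor_eq_iff, le_div_iff₀ hpi, div_lt_iff₀ hpi]
      exact ⟨by linarith [ht.1], by linarith⟩
    rw [extend, h1]

theorem extend_eq_strand (j : Fin s) {t : ℝ} (ht : t ∈ Set.Icc (0 : ℝ) (2 * Real.pi)) :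
    B.extend j t = B.strand j t := by
  have h := B.extend_eq 0 j (t := t) (by simpa using ht)
  simpa using h

theorem continuous_extend (j : Fin s) : Continuous (B.extend j) := by
  have hpi := Real.two_pi_pos
  have hfin : LocallyFinite fun n : ℤ =>
      Set.Icc (2 * Real.pi * (n : ℝ)) (2 * Real.pi * ((n : ℝ) + 1)) := by
    refine locallyFinite_Icc_of_tendsto ?_ ?_
    · exact tendsto_intCast_atTop_atTop.const_mul_atTop hpi
    · exact (Filter.tendsto_atBot_add_const_right _ _
        ((tendsto_intCast_atBot_iff (R := ℝ)).2 Filter.tendsto_id)).const_mul_atBot hpi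
  refine hfin.continuous (Set.eq_univ_of_forall fun t => Set.mem_iUnion.2
    ⟨⌊t / (2 * Real.pi)⌋, ?_⟩) (fun n => isClosed_Icc) fun n => ?_
  · have h1 := Int.floor_le (t / (2 * Real.pi))
    have h2 := (Int.lt_floor_add_one (t / (2 * Real.pi))).le
    rw [le_div_iff₀ hpi] at h1
    rw [div_le_iff₀ hpi] at h2
    exact ⟨by linarith, by linarith⟩
  · refine ContinuousOn.congr (f := fun t => B.strand ((B.perm ^ n) j) (t - 2 * Real.pi * n)) ?_
      fun t ht => B.extend_eq n j ht
    refine (B.continuousOn _).comp (by fun_prop) fun t ht => ⟨?_, ?_⟩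
    · linarith [ht.1]
    · linarith [ht.2]

end GeometricBraid

/-! ### Cycles of a permutation -/

/-- The cycles of a permutation, numbered together with their elements: the element of index
`(C, j)` is the `j`-th image of the base point `x C` of the cycle `C`. -/
theorem Equiv.Perm.exists_cycle_labelling {ι : Type*} [Fintype ι] (σ : Equiv.Perm ι) :
    ∃ (n : ℕ) (len : Fin n → ℕ) (label : ι ≃ Σ C, Fin (len C)) (x : Fin n → ι),
      (∀ C, 0 < len C) ∧ (∀ C, (σ ^ len C) (x C) = x C) ∧
      ∀ C (j : Fin (len C)), label.symm ⟨C, j⟩ = (σ ^ (j : ℕ)) (x C) := by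
  classical
  let Q := Quotient (Equiv.Perm.SameCycle.setoid σ)
  let e : Fin (Fintype.card Q) ≃ Q := (Fintype.equivFin Q).symm
  let x : Fin (Fintype.card Q) → ι := fun C => (e C).out
  let len : Fin (Fintype.card Q) → ℕ := fun C => Function.minimalPeriod σ (x C)
  have hlen : ∀ C, 0 < len C := fun C =>
    Function.IsPeriodicPt.minimalPeriod_pos (orderOf_pos σ) (by
      rw [Function.IsPeriodicPt, Function.IsFixedPt, Equiv.Perm.iterate_eq_pow, pow_orderOf_eq_one,
        Equiv.Perm.one_apply])
  have hcl : ∀ C (m : ℕ), (Quotient.mk _ ((σ ^ m) (x C)) : Q) = e C := fun C m => by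
    rw [← Quotient.out_eq (e C)]
    refine Quotient.sound ?_
    change Equiv.Perm.SameCycle σ _ _
    exact (Equiv.Perm.sameCycle_pow_left).2 (Equiv.Perm.SameCycle.refl σ _)
  let f : (Σ C, Fin (len C)) → ι := fun p => (σ ^ (p.2 : ℕ)) (x p.1)
  have hf : Function.Bijective f := by
    constructor
    · rintro ⟨C, i⟩ ⟨C', i'⟩ h
      have h1 : (σ ^ (i : ℕ)) (x C) = (σ ^ (i' : ℕ)) (x C') := h
      have h2 : C = C' := e.injective (by rw [← hcl C i, ← hcl C' i', h1])
      subst h2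
      rw [← Equiv.Perm.iterate_eq_pow, ← Equiv.Perm.iterate_eq_pow] at h1
      have h3 := Function.iterate_injOn_Iio_minimalPeriod (f := σ) (x := x C) i.2 i'.2 h1
      rw [Fin.ext h3]
    · intro y
      let C := e.symm (Quotient.mk _ y)
      have h1 : Equiv.Perm.SameCycle σ (x C) y := by
        have h2 : (Quotient.mk _ (x C) : Q) = Quotient.mk _ y := by
          simp only [x, C, Equiv.apply_symm_apply, Quotient.out_eq]
        exact Quotient.exact h2
      obtain ⟨m, hm⟩ := h1.exists_nat_pow_eq
      refine ⟨⟨C, ⟨m % len C, Nat.mod_lt _ (hlen C)⟩⟩, ?_⟩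
      change (σ ^ (m % len C)) (x C) = y
      rw [← hm, ← Equiv.Perm.iterate_eq_pow, ← Equiv.Perm.iterate_eq_pow]
      exact Function.iterate_mod_minimalPeriod_eq
  refine ⟨_, len, (Equiv.ofBijective f hf).symm, x, hlen, fun C => ?_, fun C j => rfl⟩
  rw [← Equiv.Perm.iterate_eq_pow]
  exact Function.iterate_minimalPeriod

/-! ### Families of polynomials: simple roots -/

open Polynomial in
theorem contDiff_eval_family {Q : ℝ → ℂ[X]} {N : ℕ} (hN : ∀ t, (Q t).natDegree < N)
    {n : ℕ∞} (hQ : ∀ i, ContDiff ℝ n fun t => (Q t).coeff i) :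
    ContDiff ℝ n fun p : ℝ × ℂ => (Q p.1).eval p.2 := by
  have h : (fun p : ℝ × ℂ => (Q p.1).eval p.2) =
      fun p => ∑ i ∈ Finset.range N, (Q p.1).coeff i * p.2 ^ i := by
    ext p
    exact eval_eq_sum_range' (hN p.1) p.2
  rw [h]
  exact ContDiff.sum fun i _ => ((hQ i).comp contDiff_fst).mul (contDiff_snd.pow i)

/-- The implicit function theorem at a simple root of a polynomial of a smooth family. -/
theorem exists_implicit_root {Q : ℝ → Polynomial ℂ} {N : ℕ} (hN : ∀ t, (Q t).natDegree < N)
    {n : ℕ∞} (hn : n ≠ 0) (hQ : ∀ i, ContDiff ℝ n fun t => (Q t).coeff i) {t₀ : ℝ} {z₀ : ℂ}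
    (h0 : (Q t₀).eval z₀ = 0) (h1 : (Q t₀).derivative.eval z₀ ≠ 0) :
    ∃ ψ : ℝ → ℂ, ContDiffAt ℝ n ψ t₀ ∧
      ∀ᶠ p : ℝ × ℂ in 𝓝 (t₀, z₀), (Q p.1).eval p.2 = 0 ↔ ψ p.1 = p.2 := by
  have hc : ContDiffAt ℝ n (fun p : ℝ × ℂ => (Q p.1).eval p.2) (t₀, z₀) :=
    (contDiff_eval_family hN hQ).contDiffAt
  have hn' : (n : ℕ∞ω) ≠ 0 := by exact_mod_cast hn
  have hinv : (fderiv ℝ (fun p : ℝ × ℂ => (Q p.1).eval p.2) (t₀, z₀) ∘L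
      .inr ℝ ℝ ℂ).IsInvertible := by
    refine ⟨(ContinuousLinearEquiv.unitsEquivAut ℂ (Units.mk0 _ h1)).restrictScalars ℝ, ?_⟩
    have h2 : HasFDerivAt (fun z => (Q t₀).eval z)
        (fderiv ℝ (fun p : ℝ × ℂ => (Q p.1).eval p.2) (t₀, z₀) ∘L .inr ℝ ℝ ℂ) z₀ :=
      HasFDerivAt.comp (g := fun p : ℝ × ℂ => (Q p.1).eval p.2) z₀
        (hc.differentiableAt hn').hasFDerivAt (hasFDerivAt_prodMk_right t₀ z₀)
    have h3 := (((Q t₀).hasDerivAt z₀).hasFDerivAt.restrictScalars ℝ).unique h2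
    rw [← h3]
    ext w
    simp
  refine ⟨hc.implicitFunction hn' hinv, hc.contDiffAt_implicitFunction hn' hinv, ?_⟩
  have h2 := hc.eventually_apply_eq_iff_implicitFunction hn' hinv
  rw [h0] at h2
  exact h2

/-- The simple roots of a one-parameter family of polynomials form a union of curves, a set of
Hausdorff dimension at most one. -/
theorem dimH_simple_roots_le {Q : ℝ → Polynomial ℂ} {N : ℕ} (hN : ∀ t, (Q t).natDegree < N)
    (hQ : ∀ i, ContDiff ℝ (1 : ℕ∞) fun t => (Q t).coeff i) :
    dimH {z : ℂ | ∃ t, (Q t).eval z = 0 ∧ (Q t).derivative.eval z ≠ 0} ≤ 1 := by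
  set Z : Set (ℝ × ℂ) := {p | (Q p.1).eval p.2 = 0 ∧ (Q p.1).derivative.eval p.2 ≠ 0} with hZ
  have h1 : {z : ℂ | ∃ t, (Q t).eval z = 0 ∧ (Q t).derivative.eval z ≠ 0} = Prod.snd '' Z := by
    ext z
    constructor
    · rintro ⟨t, ht⟩
      exact ⟨(t, z), ht, rfl⟩
    · rintro ⟨⟨t, z⟩, ht, rfl⟩
      exact ⟨t, ht⟩
  rw [h1]
  refine (LipschitzWith.prod_snd.dimH_image_le Z).trans ?_
  by_contra! hlt
  obtain ⟨⟨t₀, z₀⟩, ⟨h0, h0'⟩, hbig⟩ := exists_mem_nhdsWithin_lt_dimH_of_lt_dimH hlt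
  obtain ⟨ψ, hψ, hiff⟩ := exists_implicit_root hN one_ne_zero hQ h0 h0'
  have hg : ContDiffAt ℝ 1 (fun t => (t, ψ t)) t₀ := contDiffAt_id.prodMk hψ
  obtain ⟨K, U, hU, hK⟩ := (hg.hasStrictFDerivAt one_ne_zero).exists_lipschitzOnWith
  have hmem : {p : ℝ × ℂ | (Q p.1).eval p.2 = 0 ↔ ψ p.1 = p.2} ∩ (U ×ˢ Set.univ) ∩ Z ∈
      𝓝[Z] (t₀, z₀) := by
    refine Filter.inter_mem (mem_nhdsWithin_of_mem_nhds (Filter.inter_mem hiff ?_))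
      self_mem_nhdsWithin
    exact prod_mem_nhds hU Filter.univ_mem
  refine absurd (hbig _ hmem) (not_lt.2 ?_)
  calc _ ≤ dimH ((fun t => (t, ψ t)) '' U) := by
        refine dimH_mono ?_
        rintro ⟨t, z⟩ ⟨⟨h2, h3⟩, h4⟩
        exact ⟨t, h3.1, Prod.ext rfl (h2.1 h4.1)⟩
    _ ≤ dimH U := hK.dimH_image_le
    _ ≤ dimH (Set.univ : Set ℝ) := dimH_mono (Set.subset_univ _)
    _ = 1 := Real.dimH_univ

/-- For a smooth one-parameter family of nonzero polynomials, almost no point is a root of a member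
of the family: a root is a simple root of some iterated derivative. -/
theorem dense_ne_root_of_family {Q : ℝ → Polynomial ℂ} {N : ℕ} (hN : ∀ t, (Q t).natDegree < N)
    (hQ : ∀ i, ContDiff ℝ (1 : ℕ∞) fun t => (Q t).coeff i) (h0 : ∀ t, Q t ≠ 0) :
    Dense {z : ℂ | ∀ t, (Q t).eval z ≠ 0} := by
  let S : ℕ → Set ℂ := fun m => {z | ∃ t, (Polynomial.derivative^[m] (Q t)).eval z = 0 ∧
    (Polynomial.derivative (Polynomial.derivative^[m] (Q t))).eval z ≠ 0}
  have hS : ∀ m, dimH (S m) ≤ 1 := fun m => by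
    refine dimH_simple_roots_le (N := N) (fun t => ?_) fun i => ?_
    · exact ((Polynomial.natDegree_iterate_derivative _ _).trans (Nat.sub_le _ _)).trans_lt (hN t)
    · simp only [Polynomial.coeff_iterate_derivative, nsmul_eq_mul]
      exact contDiff_const.mul (hQ _)
  have hdim : dimH (⋃ m, S m) < Module.finrank ℝ ℂ := by
    rw [dimH_iUnion, Complex.finrank_real_complex]
    refine (iSup_le hS).trans_lt ?_
    norm_num
  refine (dense_compl_of_dimH_lt_finrank hdim).mono fun z hz t ht =>
    (Set.mem_compl_iff _ _).1 hz ?_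
  have hex : ∃ m, (Polynomial.derivative^[m] (Q t)).eval z ≠ 0 := by
    by_contra! hall
    have h1 : Polynomial.taylor z (Q t) ≠ 0 := fun h =>
      h0 t ((Polynomial.taylor_eq_zero z (Q t)).1 h)
    obtain ⟨m, hm⟩ := Polynomial.ext_iff.not.1 h1 |> not_forall.1
    refine hm ?_
    rw [Polynomial.taylor_coeff, Polynomial.coeff_zero]
    have h2 := hall m
    rw [← Polynomial.factorial_smul_hasseDeriv] at h2
    simpa [Nat.factorial_ne_zero] using h2
  classical
  obtain ⟨m, hm⟩ : ∃ m, Nat.find hex = m + 1 := by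
    refine Nat.exists_eq_succ_of_ne_zero fun h => ?_
    have := Nat.find_spec hex
    rw [h] at this
    exact this ht
  refine Set.mem_iUnion.2 ⟨m, t, ?_, ?_⟩
  · have := Nat.find_min hex (m := m) (by omega)
    exact not_not.1 this
  · have := Nat.find_spec hex
    rwa [hm, Function.iterate_succ_apply'] at this

/-- The roots of a smooth family of polynomials with simple roots are globally smooth functions of
the parameter: the set of pairs `(t, root)` is a covering of the line. -/
theorem exists_contDiff_roots {Q : ℝ → Polynomial ℂ} {n : ℕ} (hdeg : ∀ t, (Q t).natDegree = n)
    {b : ℂ} (hb : b ≠ 0) (hlead : ∀ t, (Q t).coeff n = b)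
    (hQ : ∀ i, ContDiff ℝ ∞ fun t => (Q t).coeff i)
    (hsimple : ∀ t z, (Q t).eval z = 0 → (Q t).derivative.eval z ≠ 0) :
    ∃ c : Fin n → ℝ → ℂ, (∀ j, ContDiff ℝ ∞ (c j)) ∧
      ∀ t, (Q t).roots = Finset.univ.val.map fun j => c j t := by
  classical
  have hQ0 : ∀ t, Q t ≠ 0 := fun t h => hb (by rw [← hlead t, h, Polynomial.coeff_zero])
  have hN : ∀ t, (Q t).natDegree < n + 1 := fun t => by rw [hdeg]; exact Nat.lt_succ_self n
  have himp := fun {t₀ z₀} (h : (Q t₀).eval z₀ = 0) =>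
    exists_implicit_root hN (n := ⊤) (by simp) hQ h (hsimple _ _ h)
  have hcont : Continuous fun p : ℝ × ℂ => (Q p.1).eval p.2 :=
    (contDiff_eval_family hN hQ).continuous
  -- the projection of the space of roots to the line is a proper local homeomorphism; its sections
  -- through the roots at time `0` are the required functions
  let E := {p : ℝ × ℂ // (Q p.1).eval p.2 = 0}
  let π : E → ℝ := fun e => e.1.1
  have hπ : Continuous π := continuous_fst.comp continuous_subtype_val
  have hval : Topology.IsClosedEmbedding (Subtype.val : E → ℝ × ℂ) :=
    (isClosed_eq hcont continuous_const).isClosedEmbedding_subtypeVal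
  have hproper : IsProperMap π := by
    refine isProperMap_iff_isCompact_preimage.2 ⟨hπ, fun K hK => ?_⟩
    obtain ⟨R, hR⟩ : ∃ R : ℝ, ∀ t ∈ K, ∀ z, (Q t).eval z = 0 → ‖z‖ ≤ R := by
      have h1 : ∀ i, ∃ M : ℝ, ∀ t ∈ K, ‖(Q t).coeff i‖ ≤ M := fun i => by
        obtain ⟨M, hM⟩ := hK.exists_bound_of_continuousOn (hQ i).continuous.continuousOn
        exact ⟨M, hM⟩
      choose M hM using h1
      refine ⟨(∑ i ∈ Finset.range n, |M i|) / ‖b‖ + 1, fun t ht z hz => ?_⟩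
      have h2 := Polynomial.IsRoot.norm_lt_cauchyBound (hQ0 t) hz
      have h3 : (Polynomial.cauchyBound (Q t) : ℝ) ≤
          (∑ i ∈ Finset.range n, |M i|) / ‖b‖ + 1 := by
        rw [Polynomial.cauchyBound, NNReal.coe_add, NNReal.coe_div, Polynomial.leadingCoeff,
          hdeg, hlead, NNReal.coe_one, coe_nnnorm]
        gcongr
        have h4 : (Finset.range n).sup (fun i => ‖(Q t).coeff i‖₊) ≤
            ∑ i ∈ Finset.range n, ‖(Q t).coeff i‖₊ :=
          Finset.sup_le fun i hi =>
            Finset.single_le_sum (f := fun i => ‖(Q t).coeff i‖₊) (fun _ _ => zero_le) hi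
        refine (NNReal.coe_le_coe.2 h4).trans ?_
        rw [NNReal.coe_sum]
        exact Finset.sum_le_sum fun i _ => (hM i t ht).trans (le_abs_self _)
      exact ((NNReal.coe_lt_coe.2 h2).trans_le h3).le
    have h1 : π ⁻¹' K = Subtype.val ⁻¹' (K ×ˢ Metric.closedBall (0 : ℂ) R) := by
      ext e
      constructor
      · intro he
        exact ⟨he, mem_closedBall_zero_iff.2 (hR _ he _ e.2)⟩
      · intro he
        exact he.1
    rw [h1]
    exact hval.isCompact_preimage (hK.prod (isCompact_closedBall 0 R))
  have hlocal : IsLocalHomeomorph π := by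
    refine IsLocalHomeomorph.mk π fun e => ?_
    obtain ⟨⟨t₀, z₀⟩, he⟩ := e
    obtain ⟨ψ, hψ, hiff⟩ := himp he
    have hψt : ψ t₀ = z₀ := (hiff.self_of_nhds).1 he
    obtain ⟨W, hWiff, hW, hWmem⟩ := eventually_nhds_iff.1 hiff
    have h1 : ∀ᶠ t in 𝓝 t₀, ContinuousAt ψ t ∧ (t, ψ t) ∈ W := by
      have h2 : ∀ᶠ t in 𝓝 t₀, ContDiffAt ℝ 1 ψ t :=
        (hψ.of_le (by exact_mod_cast le_top)).eventually (by simp)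
      have h3 : ContinuousAt (fun t => (t, ψ t)) t₀ := continuousAt_id.prodMk hψ.continuousAt
      refine (h2.mono fun t ht => ht.continuousAt).and (h3.eventually_mem ?_)
      simp only [hψt]
      exact hW.mem_nhds hWmem
    obtain ⟨U, hU, hUo, hUt⟩ := eventually_nhds_iff.1 h1
    have hroot : ∀ t ∈ U, (Q t).eval (ψ t) = 0 := fun t ht => (hWiff _ (hU t ht).2).2 rfl
    refine ⟨{ toFun := π
              invFun := fun t => if h : (Q t).eval (ψ t) = 0 then ⟨(t, ψ t), h⟩
                else ⟨(t₀, z₀), he⟩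
              source := {e | e.1 ∈ W ∧ e.1.1 ∈ U}
              target := U
              map_source' := fun e h => h.2
              map_target' := fun t ht => ?_
              left_inv' := fun e h => ?_
              right_inv' := fun t ht => ?_
              open_source := ?_
              open_target := hUo
              continuousOn_toFun := hπ.continuousOn
              continuousOn_invFun := ?_ }, ⟨hWmem, hUt⟩, fun _ _ => rfl⟩
    · rw [dif_pos (hroot t ht)]
      exact ⟨(hU t ht).2, ht⟩
    · rw [dif_pos (hroot _ h.2)]
      exact Subtype.ext (Prod.ext rfl ((hWiff _ h.1).1 e.2))
    · rw [dif_pos (hroot t ht)]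
    · refine hval.isInducing.continuousOn_iff.2 ?_
      have h2 : ContinuousOn (fun t => (t, ψ t)) U := fun t ht =>
        (continuousAt_id.prodMk (hU t ht).1).continuousWithinAt
      refine h2.congr fun t ht => ?_
      simp only [Function.comp_apply, dif_pos (hroot t ht)]
    · exact (hW.preimage continuous_subtype_val).inter (hUo.preimage hπ)
  have hcov : IsCoveringMap π := by
    rw [isCoveringMap_iff_isCoveringMapOn_univ]
    refine hproper.isClosedMap.isCoveringMapOn_of_isLocalHomeomorphOn (fun t _ => ?_)
      (hlocal.isLocalHomeomorphOn)
    refine Set.Finite.of_finite_image (f := fun e : E => e.1.2)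
      ((Q t).roots.toFinset.finite_toSet.subset ?_) ?_
    · rintro _ ⟨e, he, rfl⟩
      have he : e.1.1 = t := he
      refine Finset.mem_coe.2 (Multiset.mem_toFinset.2 ((Polynomial.mem_roots (hQ0 t)).2 ?_))
      rw [← he]
      exact e.2
    · intro e he e' he' h
      have he : e.1.1 = t := he
      have he' : e'.1.1 = t := he'
      exact Subtype.ext (Prod.ext (he.trans he'.symm) h)
  have hnodup : ∀ t, (Q t).roots.Nodup := fun t =>
    Multiset.nodup_iff_count_le_one.2 fun z => by
      rw [Polynomial.count_roots]
      by_contra! h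
      have h2 := (Polynomial.one_lt_rootMultiplicity_iff_isRoot (hQ0 t)).1 h
      exact hsimple t z h2.1 h2.2
  have hcard : ∀ t, (Q t).roots.card = n := fun t => by
    rw [← hdeg t]
    exact (IsAlgClosed.splits (Q t)).natDegree_eq_card_roots.symm
  have hcard0 : (Q 0).roots.toFinset.card = n := by
    rw [Multiset.toFinset_card_of_nodup (hnodup 0), hcard 0]
  let e := (Finset.equivFinOfCardEq hcard0).symm
  have he : ∀ j, (Q 0).eval (e j : ℂ) = 0 := fun j =>
    (Polynomial.mem_roots (hQ0 0)).1 (Multiset.mem_toFinset.1 (e j).2)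
  choose F hF hFπ using fun j => (hcov.existsUnique_continuousMap_lifts (ContinuousMap.id ℝ) 0
    ⟨(0, (e j : ℂ)), he j⟩ rfl).exists
  have hF1 : ∀ j t, (F j t).1.1 = t := fun j t => congrFun (hFπ j) t
  have hinj : ∀ t, Function.Injective fun j => (F j t).1.2 := fun t i j hij => by
    have h1 : F i t = F j t := Subtype.ext (Prod.ext (by rw [hF1, hF1]) hij)
    have h2 : (F i : ℝ → E) = F j := hcov.eq_of_comp_eq (F i).continuous (F j).continuous
      ((hFπ i).trans (hFπ j).symm) t h1
    have h3 := congrFun h2 0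
    rw [hF, hF] at h3
    exact e.injective (Subtype.ext (congrArg (fun x : E => x.1.2) h3))
  have hroot : ∀ j t, (Q t).eval (F j t).1.2 = 0 := fun j t => by
    have h1 := (F j t).2
    rwa [hF1] at h1
  refine ⟨fun j t => (F j t).1.2, fun j => contDiff_iff_contDiffAt.2 fun t => ?_, fun t => ?_⟩
  · obtain ⟨ψ, hψ, hiff⟩ := himp (hroot j t)
    refine hψ.congr_of_eventuallyEq ?_
    have h1 : Continuous fun t' => (t', (F j t').1.2) :=
      continuous_id.prodMk (continuous_snd.comp (continuous_subtype_val.comp (F j).continuous))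
    filter_upwards [h1.continuousAt.eventually hiff] with t' ht'
    exact (ht'.1 (hroot j t')).symm
  · refine (Multiset.eq_of_le_of_card_le ?_ ?_).symm
    · refine (Multiset.le_iff_subset ?_).2 fun z hz => ?_
      · exact Finset.univ.nodup.map (hinj t)
      · obtain ⟨j, -, rfl⟩ := Multiset.mem_map.1 hz
        exact (Polynomial.mem_roots (hQ0 t)).2 (hroot j t)
    · rw [hcard t]
      simp

/-! ### Polynomials with simple critical points -/

section SimpleCritical

open Polynomial

variable {ι : Type*} [Fintype ι]

/-- The monic polynomial with the roots `z j`. -/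
noncomputable def rootPoly (z : ι → ℂ) : ℂ[X] := ∏ j, (X - C (z j))

/-- All critical points of the polynomial with the roots `z j` are simple. -/
def HasSimpleCriticalPoints (z : ι → ℂ) : Prop :=
  ∀ c, (derivative (rootPoly z)).eval c = 0 → (derivative (derivative (rootPoly z))).eval c ≠ 0

theorem rootPoly_monic (z : ι → ℂ) : (rootPoly z).Monic := monic_prod_X_sub_C z Finset.univ

theorem natDegree_rootPoly (z : ι → ℂ) : (rootPoly z).natDegree = Fintype.card ι := by
  rw [rootPoly, natDegree_finsetProd_X_sub_C_eq_card]
  rfl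

theorem natDegree_derivative_rootPoly (z : ι → ℂ) :
    (derivative (rootPoly z)).natDegree = Fintype.card ι - 1 := by
  rw [natDegree_derivative, natDegree_rootPoly]

theorem eval_rootPoly (z : ι → ℂ) (c : ℂ) : (rootPoly z).eval c = ∏ j, (c - z j) := by
  simp [rootPoly, eval_prod]

theorem rootPoly_comp_perm (z : ι → ℂ) (σ : Equiv.Perm ι) :
    rootPoly (fun j => z (σ j)) = rootPoly z :=
  Equiv.prod_comp σ fun j => X - C (z j)

/-- Simplicity of the critical points is invariant under affine maps. -/
theorem HasSimpleCriticalPoints.affine {z : ι → ℂ} (h : HasSimpleCriticalPoints z) {a : ℂ}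
    (ha : a ≠ 0) (b : ℂ) : HasSimpleCriticalPoints fun j => a * z j + b := by
  set q : ℂ[X] := C a⁻¹ * (X - C b) with hq
  have hq' : derivative q = C a⁻¹ := by simp [hq]
  have h1 : rootPoly (fun j => a * z j + b) = C (a ^ Fintype.card ι) * (rootPoly z).comp q := by
    rw [rootPoly, rootPoly, prod_comp, ← Finset.card_univ, C_pow, ← Finset.prod_const,
      ← Finset.prod_mul_distrib]
    refine Finset.prod_congr rfl fun j _ => ?_
    rw [sub_comp, X_comp, C_comp, hq, mul_sub (C a), ← mul_assoc, ← C_mul, mul_inv_cancel₀ ha,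
      C_1, one_mul, ← C_mul, C_add]
    ring
  intro c hc
  rw [h1, derivative_C_mul, derivative_comp, hq'] at hc ⊢
  rw [derivative_C_mul, derivative_C_mul, derivative_comp, hq']
  have hn : a ^ Fintype.card ι ≠ 0 := pow_ne_zero _ ha
  have hi : a⁻¹ ≠ 0 := inv_ne_zero ha
  simp only [eval_mul, eval_C, eval_comp, mul_eq_zero, hn, hi, false_or, ne_eq] at hc ⊢
  exact h _ hc

/-- A polynomial all of whose roots are real and at most double has simple critical points. -/
theorem hasSimpleCriticalPoints_of_real [Nonempty ι] (r : ι → ℝ)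
    (hr : ∀ i j k, i ≠ j → i ≠ k → j ≠ k → ¬ (r i = r j ∧ r i = r k)) :
    HasSimpleCriticalPoints fun j => (r j : ℂ) := by
  classical
  intro c h1 h2
  set g := rootPoly fun j => (r j : ℂ) with hg
  have hgne : g ≠ 0 := (rootPoly_monic _).ne_zero
  by_cases hc : g.eval c = 0
  · have hdne : derivative g ≠ 0 := fun h => by
      have h3 := derivative_eq_zero.1 h
      rw [natDegree_rootPoly] at h3
      exact Fintype.card_ne_zero h3
    have h3 : 1 < (derivative g).rootMultiplicity c :=
      (one_lt_rootMultiplicity_iff_isRoot hdne).2 ⟨h1, h2⟩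
    rw [derivative_rootMultiplicity_of_root hc, ← count_roots, hg, rootPoly,
      roots_prod _ _ (by rw [← rootPoly]; exact hgne)] at h3
    have h4 : (Multiset.bind Finset.univ.val fun j => (X - C ((r j : ℝ) : ℂ)).roots) =
        Finset.univ.val.map fun j => ((r j : ℝ) : ℂ) := by
      simp only [roots_X_sub_C, Multiset.bind_singleton]
    rw [h4, Multiset.count_map] at h3
    have h5 : 2 < (Finset.univ.filter fun j => c = (r j : ℂ)).card := by
      change 1 < (Finset.univ.filter fun j => c = (r j : ℂ)).card - 1 at h3
      omega
    obtain ⟨i, j, k, hi, hj, hk, hij, hik, hjk⟩ := Finset.two_lt_card_iff.1 h5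
    simp only [Finset.mem_filter, Finset.mem_univ, true_and] at hi hj hk
    refine hr i j k hij hik hjk ⟨?_, ?_⟩
    · exact_mod_cast hi.symm.trans hj
    · exact_mod_cast hi.symm.trans hk
  · have hne : ∀ j, c - r j ≠ 0 := fun j h => hc (by
      rw [hg, eval_rootPoly]
      exact Finset.prod_eq_zero (Finset.mem_univ j) h)
    let S : ℂ → ℂ := fun u => ∑ j, (u - r j)⁻¹
    have hS : ∀ u, g.eval u ≠ 0 → (derivative g).eval u = g.eval u * S u := fun u hu => by
      have h3 := (IsAlgClosed.splits g).eval_derivative_eq_eval_mul_sum hu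
      rw [h3, hg, rootPoly, roots_prod _ _ (by rw [← rootPoly]; exact hgne)]
      simp [S]
    have hSc : S c = 0 := by
      have h3 := hS c hc
      rw [h1] at h3
      exact (mul_eq_zero.1 h3.symm).resolve_left hc
    -- the imaginary part of `S c` shows that `c` is real
    have him : c.im = 0 := by
      have h3 : (S c).im = -c.im * ∑ j, (Complex.normSq (c - r j))⁻¹ := by
        simp only [S, Complex.im_sum, Complex.inv_im, Complex.sub_im, Complex.ofReal_im, sub_zero]
        rw [Finset.mul_sum]
        rfl
      rw [hSc, Complex.zero_im] at h3
      have h4 : 0 < ∑ j, (Complex.normSq (c - r j))⁻¹ :=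
        Finset.sum_pos (fun j _ => inv_pos.2 (Complex.normSq_pos.2 (hne j)))
          Finset.univ_nonempty
      have h5 := (mul_eq_zero.1 h3.symm).resolve_right h4.ne'
      exact neg_eq_zero.1 h5
    have hcr : c = (c.re : ℂ) := Complex.ext rfl (by simpa using him)
    have hS' : HasDerivAt S (∑ j, -((c - r j) ^ 2)⁻¹) c := by
      refine HasDerivAt.fun_sum fun j _ => ?_
      have h3 := ((hasDerivAt_id c).sub_const (r j : ℂ)).inv (hne j)
      rw [neg_div, one_div] at h3
      exact h3
    have h3 : HasDerivAt (fun u => (derivative g).eval u)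
        ((derivative g).eval c * S c + g.eval c * ∑ j, -((c - r j) ^ 2)⁻¹) c := by
      refine ((g.hasDerivAt c).mul hS').congr_of_eventuallyEq ?_
      have h4 : ∀ᶠ u in 𝓝 c, g.eval u ≠ 0 := g.continuous.continuousAt.eventually_ne hc
      filter_upwards [h4] with u hu
      exact hS u hu
    have h4 := ((derivative g).hasDerivAt c).unique h3
    rw [h2, h1, zero_mul, zero_add] at h4
    have h5 := (mul_eq_zero.1 h4.symm).resolve_left hc
    have h6 : ∑ j, -((c - r j) ^ 2)⁻¹ = -((∑ j, ((c.re - r j) ^ 2)⁻¹ : ℝ) : ℂ) := by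
      conv_lhs => rw [hcr]
      push_cast
      rw [Finset.sum_neg_distrib]
    rw [h6, neg_eq_zero, Complex.ofReal_eq_zero] at h5
    have h7 : 0 < ∑ j, ((c.re - r j) ^ 2)⁻¹ := by
      refine Finset.sum_pos (fun j _ => inv_pos.2 (sq_pos_of_ne_zero fun h => hne j ?_))
        Finset.univ_nonempty
      rw [hcr, ← Complex.ofReal_sub, h, Complex.ofReal_zero]
    exact h7.ne' h5

/-- The discriminant of the derivative, as a polynomial in the roots of the original polynomial. -/
noncomputable def criticalDiscr (ι : Type*) [Fintype ι] : MvPolynomial ι ℂ :=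
  resultant (derivative (∏ j : ι, (X - C (MvPolynomial.X j))))
    (derivative (derivative (∏ j : ι, (X - C (MvPolynomial.X j)))))
    (Fintype.card ι - 1) (Fintype.card ι - 1 - 1)

theorem eval_criticalDiscr_ne_zero_iff (hι : 2 ≤ Fintype.card ι) (z : ι → ℂ) :
    MvPolynomial.eval z (criticalDiscr ι) ≠ 0 ↔ HasSimpleCriticalPoints z := by
  have hG : (∏ j : ι, (X - C (MvPolynomial.X (R := ℂ) j))).map (MvPolynomial.eval z) =
      rootPoly z := by
    rw [Polynomial.map_prod, rootPoly]
    exact Finset.prod_congr rfl fun j _ => by simp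
  have hd := natDegree_derivative_rootPoly z
  have hdne : derivative (rootPoly z) ≠ 0 := fun h => by
    rw [h, natDegree_zero] at hd
    omega
  rw [criticalDiscr, ← resultant_map_map, ← derivative_map, ← derivative_map, hG,
    ← derivative_map, hG]
  have hdd : (derivative (derivative (rootPoly z))).natDegree = Fintype.card ι - 1 - 1 := by
    rw [natDegree_derivative, hd]
  rw [← hd] at hdd ⊢
  rw [← hdd, Ne, resultant_eq_zero_iff]
  simp only [hdne, ne_eq, not_false_eq_true, true_or, true_and, not_not]
  rw [isCoprime_iff_aeval_ne_zero_of_isAlgClosed ℂ ℂ]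
  simp only [coe_aeval_eq_eval, HasSimpleCriticalPoints, ne_eq, or_iff_not_imp_left, not_not]

end SimpleCritical

/-! ### Making the critical points simple -/

/-- For every permutation there are real exponential polynomials, permuted by the translation by
`2π`, at most two of which agree at any time: for each cycle take the projections of the vertices of
a rotating regular polygon to a line. -/
theorem exists_equivariant_at_most_double {ι : Type*} [Fintype ι] (σ : Equiv.Perm ι) :
    ∃ η : ι → ℝ → ℝ, (∀ j, (fun t => (η j t : ℂ)) ∈ expPoly) ∧
      (∀ j t, η j (t + 2 * Real.pi) = η (σ j) t) ∧ (∃ M, ∀ j t, |η j t| ≤ M) ∧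
      ∀ t i j k, i ≠ j → i ≠ k → j ≠ k → ¬ (η i t = η j t ∧ η i t = η k t) := by
  obtain ⟨n, len, label, x, hlen, hx, hlabel⟩ := σ.exists_cycle_labelling
  have hlen' : ∀ C, (len C : ℝ) ≠ 0 := fun C => by exact_mod_cast (hlen C).ne'
  let η' : (Σ C, Fin (len C)) → ℝ → ℝ := fun p t =>
    3 * ((p.1 : ℕ) : ℝ) + Real.cos ((len p.1 : ℝ)⁻¹ * t + 2 * Real.pi * ((p.2 : ℕ) : ℝ) / len p.1)
  have hpow : ∀ C (m : ℕ), label ((σ ^ m) (x C)) = ⟨C, ⟨m % len C, Nat.mod_lt _ (hlen C)⟩⟩ :=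
    fun C m => by
      rw [← label.eq_symm_apply, hlabel]
      have h1 : ∀ q : ℕ, (σ ^ (len C * q)) (x C) = x C := fun q => by
        induction q with
        | zero => simp
        | succ q ih => rw [Nat.mul_succ, pow_add, Equiv.Perm.mul_apply, hx, ih]
      conv_lhs => rw [← Nat.mod_add_div m (len C), pow_add, Equiv.Perm.mul_apply, h1]
  have hη : ∀ C (m : ℕ) t, η' (label ((σ ^ m) (x C))) t =
      3 * ((C : ℕ) : ℝ) + Real.cos ((len C : ℝ)⁻¹ * t + 2 * Real.pi * m / len C) := fun C m t => by
    rw [hpow]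
    simp only [η']
    congr 1
    have h1 : (m : ℝ) = (m % len C : ℕ) + len C * (m / len C : ℕ) := by
      exact_mod_cast (Nat.mod_add_div m (len C)).symm
    have h2 : (len C : ℝ)⁻¹ * t + 2 * Real.pi * m / len C =
        (len C : ℝ)⁻¹ * t + 2 * Real.pi * (m % len C : ℕ) / len C +
          (m / len C : ℕ) * (2 * Real.pi) := by
      rw [h1]
      have := hlen' C
      field_simp
      ring
    rw [h2, Real.cos_add_nat_mul_two_pi]
  have hrep : ∀ j, ∃ C, ∃ m : ℕ, j = (σ ^ m) (x C) := fun j =>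
    ⟨(label j).1, (label j).2, by rw [← hlabel, Sigma.eta, Equiv.symm_apply_apply]⟩
  refine ⟨fun j => η' (label j), fun j => ?_, fun j t => ?_, ⟨3 * n + 1, fun j t => ?_⟩, ?_⟩
  · have h1 := expPoly.add_mem (const_mem_expPoly (3 * (((label j).1 : ℕ) : ℂ)))
      (cos_mem_expPoly ((len (label j).1 : ℝ)⁻¹)
        (2 * Real.pi * (((label j).2 : ℕ) : ℝ) / len (label j).1))
    convert h1 using 1
    ext t
    simp [η']
  · obtain ⟨C, m, rfl⟩ := hrep j
    dsimp only
    rw [← Equiv.Perm.mul_apply, ← pow_succ', hη, hη]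
    congr 2
    push_cast
    ring
  · have h1 : ((((label j).1 : ℕ)) : ℝ) ≤ n := by exact_mod_cast (label j).1.2.le
    have h0 : (0 : ℝ) ≤ (((label j).1 : ℕ) : ℝ) := by positivity
    simp only [η']
    refine (abs_add_le _ _).trans ?_
    rw [abs_of_nonneg (by positivity)]
    linarith [Real.abs_cos_le_one ((len (label j).1 : ℝ)⁻¹ * t +
      2 * Real.pi * (((label j).2 : ℕ) : ℝ) / len (label j).1)]
  · -- equal values lie on the same cycle, and are taken at opposite angles
    have key : ∀ t (p q : Σ C, Fin (len C)), p ≠ q → η' p t = η' q t → p.1 = q.1 ∧ ∃ l : ℤ,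
        (len q.1 : ℝ)⁻¹ * t + 2 * Real.pi * ((q.2 : ℕ) : ℝ) / len q.1 = 2 * l * Real.pi -
          ((len p.1 : ℝ)⁻¹ * t + 2 * Real.pi * ((p.2 : ℕ) : ℝ) / len p.1) := by
      rintro t ⟨C, i⟩ ⟨C', i'⟩ hpq h
      simp only [η'] at h
      have hC : C = C' := by
        by_contra hne
        have h1 := Real.abs_cos_le_one ((len C : ℝ)⁻¹ * t + 2 * Real.pi * ((i : ℕ) : ℝ) / len C)
        have h2 := Real.abs_cos_le_one
          ((len C' : ℝ)⁻¹ * t + 2 * Real.pi * ((i' : ℕ) : ℝ) / len C')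
        rw [abs_le] at h1 h2
        rcases lt_or_gt_of_ne (fun h => hne (Fin.ext h) : (C : ℕ) ≠ C') with h3 | h3
        · have h4 : ((C : ℕ) : ℝ) + 1 ≤ ((C' : ℕ) : ℝ) := by exact_mod_cast h3
          linarith [h1.1, h1.2, h2.1, h2.2]
        · have h4 : ((C' : ℕ) : ℝ) + 1 ≤ ((C : ℕ) : ℝ) := by exact_mod_cast h3
          linarith [h1.1, h1.2, h2.1, h2.2]
      subst hC
      refine ⟨rfl, ?_⟩
      obtain ⟨l, hl | hl⟩ := Real.cos_eq_cos_iff.1 (add_left_cancel h)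
      · exfalso
        have h1 := hlen' C
        have h2 : ((i' : ℕ) : ℝ) = i + l * len C := by
          refine mul_left_cancel₀ Real.two_pi_pos.ne' ?_
          field_simp at hl
          linear_combination hl
        have h3 : (i' : ℤ) = i + l * len C := by exact_mod_cast h2
        have h4 : (i : ℤ) = i' := by
          have h5 : (i' : ℤ) % len C = (i : ℤ) % len C := by
            rw [h3, Int.add_mul_emod_self_right]
          rw [Int.emod_eq_of_lt (by positivity) (by exact_mod_cast i'.2),
            Int.emod_eq_of_lt (by positivity) (by exact_mod_cast i.2)] at h5
          exact h5.symm
        exact hpq (by rw [Fin.ext (by exact_mod_cast h4 : (i : ℕ) = i')])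
      · exact ⟨l, hl⟩
    rintro t i j k hij hik hjk ⟨h1, h2⟩
    obtain ⟨hc1, l, hl⟩ := key t _ _ (fun h => hij (label.injective h)) h1
    obtain ⟨hc2, l', hl'⟩ := key t _ _ (fun h => hik (label.injective h)) h2
    -- the angles of `j` and `k` are both opposite to that of `i`, hence agree modulo `2π`
    generalize label i = p at *
    generalize hq : label j = q at *
    generalize hr : label k = r at *
    obtain ⟨C, i⟩ := p
    obtain ⟨C', j'⟩ := q
    obtain ⟨C'', k'⟩ := r
    simp only at hc1 hc2
    subst hc1
    subst hc2
    simp only at hl hl'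
    have h4 := hlen' C
    have h3 : ((j' : ℕ) : ℝ) = k' + (l - l' : ℤ) * len C := by
      refine mul_left_cancel₀ Real.two_pi_pos.ne' ?_
      push_cast
      field_simp at hl hl'
      linear_combination hl - hl'
    have h7 : (j' : ℤ) = k' + (l - l') * len C := by exact_mod_cast h3
    have h8 : (j' : ℤ) % len C = (k' : ℤ) % len C := by rw [h7, Int.add_mul_emod_self_right]
    rw [Int.emod_eq_of_lt (by positivity) (by exact_mod_cast j'.2),
      Int.emod_eq_of_lt (by positivity) (by exact_mod_cast k'.2)] at h8
    refine hjk (label.injective ?_)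
    rw [hq, hr, Fin.ext (by exact_mod_cast h8 : (j' : ℕ) = k')]

open Polynomial in
/-- A small multiple of `η` can be added to the strands `f` such that all critical points become
simple, at all times. -/
theorem exists_small_hasSimpleCriticalPoints {ι : Type*} [Fintype ι] (hι : 2 ≤ Fintype.card ι)
    {f η : ι → ℝ → ℂ} (hf : ∀ j, f j ∈ expPoly) (hη : ∀ j, η j ∈ expPoly)
    (hcrit : ∀ t, HasSimpleCriticalPoints fun j => η j t) {ε : ℝ} (hε : 0 < ε) :
    ∃ e : ℂ, ‖e‖ < ε ∧ ∀ t, HasSimpleCriticalPoints fun j => f j t + e * η j t := by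
  let ev : ℝ → (expPoly →ₐ[ℂ] ℂ) := fun t => (Pi.evalAlgHom ℂ (fun _ : ℝ => ℂ) t).comp expPoly.val
  -- the discriminant as a polynomial in `e`, whose coefficients are exponential polynomials in `t`
  let P : expPoly[X] := MvPolynomial.aeval
    (fun j => C (⟨f j, hf j⟩ : expPoly) + X * C (⟨η j, hη j⟩ : expPoly)) (criticalDiscr ι)
  have hP : ∀ t e, (P.map (ev t : expPoly →+* ℂ)).eval e =
      MvPolynomial.eval (fun j => f j t + e * η j t) (criticalDiscr ι) := fun t e => by
    have h1 : ((Polynomial.aeval e).comp (Polynomial.mapAlgHom (ev t))).comp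
        (MvPolynomial.aeval
          (fun j => C (⟨f j, hf j⟩ : expPoly) + X * C (⟨η j, hη j⟩ : expPoly))) =
        MvPolynomial.aeval (fun j => f j t + e * η j t) := by
      refine MvPolynomial.algHom_ext fun j => ?_
      simp [ev]
      ring
    exact DFunLike.congr_fun h1 (criticalDiscr ι)
  have h0 : ∀ t, P.map (ev t : expPoly →+* ℂ) ≠ 0 := fun t h => by
    -- for large `e` the roots `e⁻¹ f + η` are close to those of `η`
    have hc : Continuous fun d : ℂ => MvPolynomial.eval (fun j => d * f j t + η j t)
        (criticalDiscr ι) :=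
      (MvPolynomial.continuous_eval (criticalDiscr ι)).comp (by fun_prop)
    have h1 : MvPolynomial.eval (fun j => (0 : ℂ) * f j t + η j t) (criticalDiscr ι) ≠ 0 := by
      rw [eval_criticalDiscr_ne_zero_iff hι]
      simpa using hcrit t
    have h2 : ∀ᶠ d in 𝓝[≠] (0 : ℂ), MvPolynomial.eval (fun j => d * f j t + η j t)
        (criticalDiscr ι) ≠ 0 :=
      (hc.continuousAt.eventually_ne h1).filter_mono nhdsWithin_le_nhds
    obtain ⟨d, hd, hd0⟩ := (h2.and self_mem_nhdsWithin).exists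
    have hd0 : d ≠ 0 := hd0
    rw [eval_criticalDiscr_ne_zero_iff hι] at hd
    have h3 := hd.affine (inv_ne_zero hd0) 0
    have h4 : (fun j => d⁻¹ * (d * f j t + η j t) + 0) = fun j => f j t + d⁻¹ * η j t := by
      ext j
      rw [add_zero, mul_add, inv_mul_cancel_left₀ hd0]
    rw [h4, ← eval_criticalDiscr_ne_zero_iff hι, ← hP, h] at h3
    simp at h3
  have hdense := dense_ne_root_of_family (Q := fun t => P.map (ev t : expPoly →+* ℂ))
    (N := P.natDegree + 1) (fun t => Nat.lt_succ_of_le natDegree_map_le) (fun i => ?_) h0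
  · obtain ⟨e, he, hball⟩ := hdense.exists_mem_open Metric.isOpen_ball
      ⟨0, Metric.mem_ball_self hε⟩
    refine ⟨e, mem_ball_zero_iff.1 hball, fun t => ?_⟩
    rw [← eval_criticalDiscr_ne_zero_iff hι, ← hP]
    exact he t
  · simp only [coeff_map]
    exact (contDiff_of_mem_expPoly (P.coeff i).2).of_le (by exact_mod_cast le_top)

/-- The strands of a braid can be approximated by exponential polynomials with the same permutation,
such that the polynomials with these roots have simple critical points. -/
theorem GeometricBraid.exists_approx_hasSimpleCriticalPoints {s : ℕ} (hs : 2 ≤ s)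
    (w : GeometricBraid s) {ε : ℝ} (hε : 0 < ε) :
    ∃ f : Fin s → ℝ → ℂ, (∀ j, f j ∈ expPoly) ∧
      (∀ j t, f j (t + 2 * Real.pi) = f (w.perm j) t) ∧ (∀ j t, ‖f j t - w.extend j t‖ < ε) ∧
      ∀ t, HasSimpleCriticalPoints fun j => f j t := by
  obtain ⟨f, hf, hfσ, hfε⟩ := exists_equivariant_approx w.perm w.continuous_extend w.extend_add
    (half_pos hε)
  obtain ⟨η, hη, hησ, ⟨M, hM⟩, hηd⟩ := exists_equivariant_at_most_double w.perm
  have hM0 : 0 ≤ M := (abs_nonneg _).trans (hM ⟨0, by omega⟩ 0)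
  have : Nonempty (Fin s) := ⟨⟨0, by omega⟩⟩
  obtain ⟨e, he, hcrit⟩ := exists_small_hasSimpleCriticalPoints (by simpa using hs) hf hη
    (fun t => hasSimpleCriticalPoints_of_real (fun j => η j t) (hηd t))
    (ε := ε / (2 * (M + 1))) (by positivity)
  refine ⟨fun j t => f j t + e * η j t,
    fun j => expPoly.add_mem (hf j) (expPoly.smul_mem (hη j) e), fun j t => ?_, fun j t => ?_,
    hcrit⟩
  · simp only [hfσ, hησ]
  · have h1 : ‖e * (η j t : ℂ)‖ ≤ ε / 2 := by
      rw [norm_mul, Complex.norm_real, Real.norm_eq_abs]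
      calc ‖e‖ * |η j t| ≤ ε / (2 * (M + 1)) * (M + 1) :=
            mul_le_mul he.le ((hM j t).trans (by linarith)) (abs_nonneg _) (by positivity)
        _ = ε / 2 := by field_simp
    calc ‖f j t + e * η j t - w.extend j t‖ = ‖(f j t - w.extend j t) + e * η j t‖ := by
          congr 1
          ring
      _ ≤ ‖f j t - w.extend j t‖ + ‖e * (η j t : ℂ)‖ := norm_add_le _ _
      _ < ε / 2 + ε / 2 := add_lt_add_of_lt_of_le (hfε j t) h1
      _ = ε := add_halves ε

/-! ### The mixed polynomial -/

theorem exists_mem_Icc_eq_norm_mul_exp (v : ℂ) :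
    ∃ t ∈ Set.Icc (0 : ℝ) (2 * Real.pi), v = ‖v‖ * Complex.exp (t * Complex.I) := by
  rcases le_or_gt 0 v.arg with h | h
  · exact ⟨v.arg, ⟨h, by linarith [v.arg_le_pi, Real.pi_pos]⟩, (v.norm_mul_exp_arg_mul_I).symm⟩
  · refine ⟨v.arg + 2 * Real.pi, ⟨by linarith [v.neg_pi_lt_arg, Real.pi_pos], by linarith⟩, ?_⟩
    conv_lhs => rw [← v.norm_mul_exp_arg_mul_I]
    push_cast
    rw [add_mul, Complex.exp_add, Complex.exp_two_pi_mul_I, mul_one]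

open Polynomial in
/-- The coefficients of the polynomial with the roots `h j t` are trigonometric polynomials, since
the roots are only permuted by the translation by `2π`. -/
theorem exists_fourier_coeff_rootPoly {ι : Type*} [Fintype ι] {h : ι → ℝ → ℂ}
    (hh : ∀ j, h j ∈ expPoly) {σ : Equiv.Perm ι}
    (hσ : ∀ j t, h j (t + 2 * Real.pi) = h (σ j) t) (m : ℕ) :
    ∃ (N : ℕ) (c : ℤ → ℂ), ∀ t : ℝ, (rootPoly fun j => h j t).coeff m =
      ∑ l ∈ Finset.Icc (-(N : ℤ)) N, c l * Complex.exp (Complex.I * l * t) := by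
  let ev : ℝ → (expPoly →ₐ[ℂ] ℂ) := fun t => (Pi.evalAlgHom ℂ (fun _ : ℝ => ℂ) t).comp expPoly.val
  let P : expPoly[X] := ∏ j, (X - C (⟨h j, hh j⟩ : expPoly))
  have hP : ∀ t, P.map (ev t : expPoly →+* ℂ) = rootPoly fun j => h j t := fun t => by
    rw [Polynomial.map_prod, rootPoly]
    exact Finset.prod_congr rfl fun j _ => by simp [ev]
  have hc : ∀ t, (rootPoly fun j => h j t).coeff m = (P.coeff m : ℝ → ℂ) t := fun t => by
    rw [← hP, coeff_map]
    rfl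
  simp only [hc]
  refine exists_fourier_of_periodic (P.coeff m).2 fun t => ?_
  rw [← hc, ← hc]
  simp only [hσ]
  rw [rootPoly_comp_perm (fun j => h j t) σ]

/-- Homogenization of the polynomial with the roots `z j`. -/
theorem prod_sub_mul_eq_sum {s : ℕ} (z : Fin s → ℂ) (u : ℂ) {b : ℂ} (hb : b ≠ 0) :
    ∏ j, (u - b * z j) =
      u ^ s + ∑ m ∈ Finset.range s, b ^ (s - m) * (rootPoly z).coeff m * u ^ m := by
  have h1 : ∏ j, (u - b * z j) = b ^ s * (rootPoly z).eval (u / b) := by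
    have h2 : b ^ s = ∏ _j : Fin s, b := by simp
    rw [eval_rootPoly, h2, ← Finset.prod_mul_distrib]
    refine Finset.prod_congr rfl fun j _ => ?_
    field_simp
  have h3 : (rootPoly z).natDegree = s := by rw [natDegree_rootPoly, Fintype.card_fin]
  have h4 : (rootPoly z).coeff s = 1 := by
    have h5 := (rootPoly_monic z).coeff_natDegree
    rwa [h3] at h5
  rw [h1, Polynomial.eval_eq_sum_range, h3, Finset.sum_range_succ, h4, mul_add, Finset.mul_sum,
    add_comm]
  congr 1
  · rw [div_pow]
    field_simp
  · refine Finset.sum_congr rfl fun m hm => ?_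
    have hbs : b ^ s = b ^ (s - m) * b ^ m := by
      rw [← pow_add, Nat.sub_add_cancel (Finset.mem_range.1 hm).le]
    rw [div_pow, hbs]
    field_simp

/-- If the roots `h j` are permuted by the translation by `2π`, then, for large `k`, the product of
the factors `u - a |v|^{2k} h_j(2 arg v)` is a polynomial in `u`, `v` and `v̄`: the coefficient of
`u^m` is a combination of the functions `|v|^{2k(s-m)} e^{2il arg v} = v^{k(s-m)+l} v̄^{k(s-m)-l}`. -/
theorem exists_mixedPolynomial_eq_prod {s : ℕ} {h : Fin s → ℝ → ℂ} (hh : ∀ j, h j ∈ expPoly)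
    {σ : Equiv.Perm (Fin s)} (hσ : ∀ j t, h j (t + 2 * Real.pi) = h (σ j) t) :
    ∃ k₀ : ℕ, ∀ a : ℝ, 0 < a → ∀ k, k₀ ≤ k → 1 ≤ k → ∃ P : MixedPolynomial,
      Sum.inr 0 ∉ P.vars ∧ (∀ u, P.toFun !₂[u, 0] = u ^ s) ∧
      ∀ (u v : ℂ) (t : ℝ), v ≠ 0 → v = ‖v‖ * Complex.exp (t * Complex.I) →
        P.toFun !₂[u, v] = ∏ j, (u - a * (‖v‖ : ℂ) ^ (2 * k) * h j (2 * t)) := by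
  choose N c hc using exists_fourier_coeff_rootPoly hh hσ
  refine ⟨(Finset.range s).sup N, fun a ha k hk hk1 => ?_⟩
  have hN : ∀ m < s, N m ≤ k * (s - m) := fun m hm =>
    ((Finset.le_sup (Finset.mem_range.2 hm)).trans hk).trans
      (Nat.le_mul_of_pos_right _ (by omega))
  let A : ℕ → ℤ → ℕ := fun m l => (((k * (s - m) : ℕ) : ℤ) + l).toNat
  let A' : ℕ → ℤ → ℕ := fun m l => (((k * (s - m) : ℕ) : ℤ) - l).toNat
  let P : MixedPolynomial := MvPolynomial.X (Sum.inl 0) ^ s + ∑ m ∈ Finset.range s,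
    ∑ l ∈ Finset.Icc (-(N m : ℤ)) (N m), MvPolynomial.C ((a : ℂ) ^ (s - m) * c m l) *
      MvPolynomial.X (Sum.inl 1) ^ A m l * MvPolynomial.X (Sum.inr 1) ^ A' m l *
        MvPolynomial.X (Sum.inl 0) ^ m
  have hP : ∀ u v, P.toFun !₂[u, v] = u ^ s + ∑ m ∈ Finset.range s,
      ∑ l ∈ Finset.Icc (-(N m : ℤ)) (N m), (a : ℂ) ^ (s - m) * c m l * v ^ A m l *
        conj v ^ A' m l * u ^ m := fun u v => by
    simp [P, MixedPolynomial.toFun]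
  have hA : ∀ m < s, ∀ l ∈ Finset.Icc (-(N m : ℤ)) (N m),
      (A m l : ℤ) = ((k * (s - m) : ℕ) : ℤ) + l ∧ (A' m l : ℤ) = ((k * (s - m) : ℕ) : ℤ) - l :=
    fun m hm l hl => by
      have h1 := Finset.mem_Icc.1 hl
      have h2 : (N m : ℤ) ≤ ((k * (s - m) : ℕ) : ℤ) := by exact_mod_cast hN m hm
      exact ⟨Int.toNat_of_nonneg (by linarith), Int.toNat_of_nonneg (by linarith)⟩
  refine ⟨P, fun h1 => ?_, fun u => ?_, fun u v t hv hvt => ?_⟩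
  · have h2 : P ∈ MvPolynomial.supported ℂ ({Sum.inr 0}ᶜ : Set (Fin 2 ⊕ Fin 2)) := by
      have hX : ∀ i, i ≠ Sum.inr 0 → (MvPolynomial.X i : MixedPolynomial) ∈
          MvPolynomial.supported ℂ ({Sum.inr 0}ᶜ : Set (Fin 2 ⊕ Fin 2)) := fun i hi =>
        MvPolynomial.X_mem_supported.2 hi
      refine Subalgebra.add_mem _ (Subalgebra.pow_mem _ (hX _ (by simp)) _)
        (Subalgebra.sum_mem _ fun m _ => Subalgebra.sum_mem _ fun l _ => ?_)
      refine Subalgebra.mul_mem _ (Subalgebra.mul_mem _ (Subalgebra.mul_mem _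
        (Subalgebra.algebraMap_mem _ _) ?_) ?_) ?_ <;>
      exact Subalgebra.pow_mem _ (hX _ (by simp)) _
    exact MvPolynomial.mem_supported.1 h2 h1 rfl
  · rw [hP, add_eq_left]
    refine Finset.sum_eq_zero fun m hm => Finset.sum_eq_zero fun l hl => ?_
    have hm : m < s := Finset.mem_range.1 hm
    obtain ⟨h1, h2⟩ := hA m hm l hl
    have h3 : 0 < k * (s - m) := Nat.mul_pos hk1 (by omega)
    have h4 : A m l ≠ 0 ∨ A' m l ≠ 0 := by omega
    rcases h4 with h4 | h4 <;> simp [h4]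
  · have hr : (‖v‖ : ℂ) ≠ 0 := by exact_mod_cast norm_ne_zero_iff.2 hv
    have hb : (a : ℂ) * (‖v‖ : ℂ) ^ (2 * k) ≠ 0 :=
      mul_ne_zero (by exact_mod_cast ha.ne') (pow_ne_zero _ hr)
    rw [hP, prod_sub_mul_eq_sum _ u hb]
    congr 1
    refine Finset.sum_congr rfl fun m hm => ?_
    rw [hc, Finset.mul_sum, Finset.sum_mul]
    refine Finset.sum_congr rfl fun l hl => ?_
    obtain ⟨h1, h2⟩ := hA m (Finset.mem_range.1 hm) l hl
    have hv' : conj v = ‖v‖ * Complex.exp (-(t * Complex.I)) := by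
      conv_lhs => rw [hvt]
      rw [map_mul, Complex.conj_ofReal, ← Complex.exp_conj, map_mul, Complex.conj_I,
        Complex.conj_ofReal, mul_neg]
    have h3 : v ^ A m l * conj v ^ A' m l =
        ((‖v‖ : ℂ) ^ (2 * k)) ^ (s - m) * Complex.exp (Complex.I * l * (2 * t : ℝ)) := by
      have h4 : A m l + A' m l = 2 * k * (s - m) := by
        zify
        rw [h1, h2]
        push_cast
        ring
      have h5 : ((A m l : ℤ) : ℂ) - ((A' m l : ℤ) : ℂ) = 2 * l := by
        rw [h1, h2]
        push_cast
        ring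
      push_cast at h5
      rw [hv', hvt, mul_pow, mul_pow, norm_mul, Complex.norm_exp_ofReal_mul_I, mul_one,
        Complex.norm_real, norm_norm, ← pow_mul, ← h4, pow_add, ← Complex.exp_nat_mul,
        ← Complex.exp_nat_mul]
      have h6 : Complex.exp (Complex.I * l * (2 * t : ℝ)) =
          Complex.exp (A m l * (t * Complex.I)) * Complex.exp (A' m l * -(t * Complex.I)) := by
        rw [← Complex.exp_add]
        congr 1
        push_cast
        linear_combination -(t * Complex.I) * h5
      rw [h6]
      ring
    calc _ = (a : ℂ) ^ (s - m) * c m l * (v ^ A m l * conj v ^ A' m l) * u ^ m := by ring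
      _ = _ := by
        rw [h3, mul_pow]
        ring

/-! ### Weak realizations -/

theorem MixedPolynomial.differentiable_toFun (P : MixedPolynomial) :
    Differentiable ℝ P.toFun := by
  have h0 : ∀ i : Fin 2, Differentiable ℝ fun x : C2 => x i := fun i =>
    ((EuclideanSpace.proj i : C2 →L[ℂ] ℂ).restrictScalars ℝ).differentiable
  have h1 : ∀ i : Fin 2 ⊕ Fin 2, Differentiable ℝ fun x : C2 =>
      Sum.elim (fun i => x i) (fun i => conj (x i)) i := by
    rintro (i | i)
    · exact h0 i
    · exact Complex.conjCLE.differentiable.comp (h0 i)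
  induction P using MvPolynomial.induction_on with
  | C c =>
    have h2 : MixedPolynomial.toFun (MvPolynomial.C c) = fun _ => c := by
      ext x
      simp [MixedPolynomial.toFun]
    rw [h2]
    exact differentiable_const c
  | add p q hp hq =>
    have h2 : MixedPolynomial.toFun (p + q) = fun x => MixedPolynomial.toFun p x +
        MixedPolynomial.toFun q x := by
      ext x
      simp [MixedPolynomial.toFun]
    rw [h2]
    exact hp.add hq
  | mul_X p i hp =>
    have h2 : MixedPolynomial.toFun (p * MvPolynomial.X i) = fun x => MixedPolynomial.toFun p x *
        Sum.elim (fun i => x i) (fun i => conj (x i)) i := by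
      ext x
      simp [MixedPolynomial.toFun]
    rw [h2]
    exact hp.mul (h1 i)

/-- A map that is holomorphic in the first variable is a submersion where the partial derivative with
respect to this variable does not vanish. -/
theorem surjective_fderiv_of_partial_ne_zero {f : C2 → ℂ} {x : C2} (hf : DifferentiableAt ℝ f x)
    {q : ℂ → ℂ} (hq : ∀ u, f !₂[u, x 1] = q u) {d : ℂ} (hd : HasDerivAt q d (x 0)) (hd0 : d ≠ 0) :
    Function.Surjective (fderiv ℝ f x) := by
  let e : C2 := !₂[1, 0]
  let L : ℂ →L[ℝ] C2 := (ContinuousLinearMap.toSpanSingleton ℂ e).restrictScalars ℝ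
  have hx : ∀ u, x + L (u - x 0) = !₂[u, x 1] := fun u => by
    ext i
    fin_cases i <;> simp [L, e]
  have h1 : HasFDerivAt (fun u => x + L (u - x 0)) L (x 0) := by
    have h2 : HasFDerivAt (fun u : ℂ => u - x 0) (ContinuousLinearMap.id ℝ ℂ) (x 0) :=
      (hasFDerivAt_id (x 0)).sub_const (x 0)
    exact (HasFDerivAt.comp (f := fun u : ℂ => u - x 0) (x 0) L.hasFDerivAt h2).const_add x
  have h3 : HasFDerivAt q ((fderiv ℝ f x).comp L) (x 0) := by
    have h4 : HasFDerivAt f (fderiv ℝ f x) (x + L (x 0 - x 0)) := by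
      simpa using hf.hasFDerivAt
    have h5 := h4.comp (x 0) h1
    refine h5.congr_of_eventuallyEq (Filter.Eventually.of_forall fun u => ?_)
    simp only [Function.comp_apply, hx, hq]
  have h6 := (hd.hasFDerivAt.restrictScalars ℝ).unique h3
  intro y
  refine ⟨L (y / d), ?_⟩
  have h7 := DFunLike.congr_fun h6 (y / d)
  simp only [ContinuousLinearMap.comp_apply] at h7
  rw [← h7]
  simp [hd0]

/-- A product of linear factors `u - c j` with pairwise different `c j` has a nonzero derivative at
each of its roots. -/
theorem exists_hasDerivAt_prod_sub_ne_zero {ι : Type*} [Fintype ι] {c : ι → ℂ}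
    (hc : Function.Injective c) (i : ι) :
    ∃ d, HasDerivAt (fun u => ∏ j, (u - c j)) d (c i) ∧ d ≠ 0 := by
  classical
  refine ⟨_, HasDerivAt.fun_finsetProd fun j _ => (hasDerivAt_id (c i)).sub_const (c j), ?_⟩
  rw [Finset.sum_eq_single i]
  · simp only [smul_eq_mul, mul_one]
    exact Finset.prod_ne_zero_iff.2 fun j hj => sub_ne_zero.2 fun h =>
      (Finset.mem_erase.1 hj).1 (hc h).symm
  · intro j _ hj
    rw [smul_eq_mul, mul_one]
    exact Finset.prod_eq_zero (Finset.mem_erase.2 ⟨hj.symm, Finset.mem_univ i⟩) (sub_self _)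
  · exact fun h => absurd (Finset.mem_univ i) h

theorem GeometricBraid.exists_norm_strand_le {s : ℕ} (B : GeometricBraid s) :
    ∃ M, ∀ j, ∀ t ∈ Set.Icc (0 : ℝ) (2 * Real.pi), ‖B.strand j t‖ ≤ M := by
  choose M hM using fun j => isCompact_Icc.exists_bound_of_continuousOn (B.continuousOn j)
  exact ⟨∑ j, |M j|, fun j t ht => (hM j t ht).trans ((le_abs_self _).trans
    (Finset.single_le_sum (f := fun j => |M j|) (fun _ _ => abs_nonneg _) (Finset.mem_univ j)))⟩

/-- If `P(u, v)` is the product of the factors `u - a |v|^{2k} γ_j(arg v)`, where the curves `γ_j` are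
the strands of a braid, then `P` is a weak realization of the closure of this braid. -/
theorem isWeakRealization_of_eq_prod {s : ℕ} (hs : 2 ≤ s) {B Q : GeometricBraid s}
    (hBQ : B.Isotopic Q) {a : ℝ} (ha : 0 < a) {k : ℕ} (hk : 1 ≤ k) {P : MixedPolynomial}
    (hP0 : ∀ u, P.toFun !₂[u, 0] = u ^ s)
    (hP : ∀ (u v : ℂ), ∀ t ∈ Set.Icc (0 : ℝ) (2 * Real.pi), v ≠ 0 →
      v = ‖v‖ * Complex.exp (t * Complex.I) →
        P.toFun !₂[u, v] = ∏ j, (u - a * (‖v‖ : ℂ) ^ (2 * k) * Q.strand j t)) :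
    IsWeakRealization P B.closure := by
  have hs0 : s ≠ 0 := by omega
  have hx2 : ∀ x : C2, x = !₂[x 0, x 1] := fun x => by
    ext i
    fin_cases i <;> rfl
  have hbase : P.toFun 0 = 0 := by
    have h1 := hP0 0
    rw [zero_pow hs0] at h1
    rw [hx2 0]
    exact h1
  obtain ⟨M, hM⟩ := Q.exists_norm_strand_le
  have hM0 : 0 ≤ M := (norm_nonneg _).trans (hM ⟨0, by omega⟩ 0 ⟨le_rfl, Real.two_pi_pos.le⟩)
  -- zeros off the axis `v = 0`
  have hzero : ∀ x : C2, x 1 ≠ 0 → (P.toFun x = 0 ↔ ∃ j, ∃ t ∈ Set.Icc (0 : ℝ) (2 * Real.pi),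
      x 1 = ‖x 1‖ * Complex.exp (t * Complex.I) ∧
        x 0 = a * (‖x 1‖ : ℂ) ^ (2 * k) * Q.strand j t) := fun x hx => by
    constructor
    · intro h
      obtain ⟨t, ht, hxt⟩ := exists_mem_Icc_eq_norm_mul_exp (x 1)
      rw [hx2 x, hP _ _ t ht hx hxt, Finset.prod_eq_zero_iff] at h
      obtain ⟨j, -, hj⟩ := h
      exact ⟨j, t, ht, hxt, sub_eq_zero.1 hj⟩
    · rintro ⟨j, t, ht, hxt, hj⟩
      rw [hx2 x, hP _ _ t ht hx hxt]
      exact Finset.prod_eq_zero (Finset.mem_univ j) (sub_eq_zero.2 hj)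
  have haxis : ∀ x : C2, x 1 = 0 → P.toFun x = 0 → x = 0 := fun x hx h => by
    rw [hx2 x, hx, hP0] at h
    rw [hx2 x, hx, eq_zero_of_pow_eq_zero h]
    ext i
    fin_cases i <;> rfl
  refine ⟨hbase, Filter.Eventually.of_forall fun x => ⟨?_, ?_⟩, 1, one_pos, fun ρ hρ _ => ?_⟩
  · rintro ⟨hsing, hx0⟩
    by_contra hne
    have hx1 : x 1 ≠ 0 := fun h => hne (haxis x h hx0)
    obtain ⟨j, t, ht, hxt, hj⟩ := (hzero x hx1).1 hx0
    have hr : (‖x 1‖ : ℂ) ≠ 0 := by exact_mod_cast norm_ne_zero_iff.2 hx1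
    have hb : (a : ℂ) * (‖x 1‖ : ℂ) ^ (2 * k) ≠ 0 :=
      mul_ne_zero (by exact_mod_cast ha.ne') (pow_ne_zero _ hr)
    obtain ⟨d, hd, hd0⟩ := exists_hasDerivAt_prod_sub_ne_zero
      (c := fun j => a * (‖x 1‖ : ℂ) ^ (2 * k) * Q.strand j t)
      (fun i i' h => Q.disjoint t ht (mul_left_cancel₀ hb h)) j
    simp only [← hj] at hd
    exact hsing (surjective_fderiv_of_partial_ne_zero (P.differentiable_toFun x)
      (fun u => hP u _ t ht hx1 hxt) hd hd0)
  · intro hx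
    have hx : x = 0 := hx
    subst hx
    refine ⟨fun hsurj => ?_, hbase⟩
    -- each of the `s ≥ 2` factors is `O(‖x‖)`
    have h1 : P.toFun =O[𝓝 (0 : C2)] fun x => ‖x - 0‖ ^ 2 := by
      refine Asymptotics.IsBigO.of_bound ((1 + a * M) ^ s) ?_
      filter_upwards [Metric.ball_mem_nhds (0 : C2) one_pos] with x hx
      have hx1 : ‖x‖ ≤ 1 := (mem_ball_zero_iff.1 hx).le
      have hu : ‖x 0‖ ≤ ‖x‖ := PiLp.norm_apply_le x 0
      have hv : ‖x 1‖ ≤ ‖x‖ := PiLp.norm_apply_le x 1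
      have hC : 1 ≤ 1 + a * M := by nlinarith
      have h2 : ‖P.toFun x‖ ≤ ((1 + a * M) * ‖x‖) ^ s := by
        rcases eq_or_ne (x 1) 0 with h | h
        · rw [hx2 x, h, hP0, norm_pow, ← h, ← hx2 x]
          refine pow_le_pow_left₀ (norm_nonneg _) (hu.trans ?_) s
          exact le_mul_of_one_le_left (norm_nonneg _) hC
        · obtain ⟨t, ht, hxt⟩ := exists_mem_Icc_eq_norm_mul_exp (x 1)
          conv_lhs => rw [hx2 x, hP _ _ t ht h hxt]
          rw [norm_prod]
          calc _ ≤ ∏ _j : Fin s, ((1 + a * M) * ‖x‖) := by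
                refine Finset.prod_le_prod (fun _ _ => norm_nonneg _) fun j _ => ?_
                refine (norm_sub_le _ _).trans ?_
                rw [norm_mul, norm_mul, norm_pow, Complex.norm_real, Complex.norm_real, norm_norm,
                  Real.norm_of_nonneg ha.le]
                have h3 : ‖x 1‖ ^ (2 * k) ≤ ‖x‖ :=
                  (pow_le_of_le_one (norm_nonneg _) (hv.trans hx1) (by omega)).trans hv
                have h4 : a * ‖x 1‖ ^ (2 * k) * ‖Q.strand j t‖ ≤ a * ‖x‖ * M := by
                  have := hM j t ht
                  gcongr
                linarith
            _ = _ := by simp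
      refine h2.trans ?_
      rw [mul_pow, sub_zero, norm_pow, norm_norm]
      exact mul_le_mul_of_nonneg_left (pow_le_pow_of_le_one (norm_nonneg _) hx1 hs) (by positivity)
    have h2 : HasFDerivAt P.toFun (0 : C2 →L[ℝ] ℂ) 0 := h1.hasFDerivAt one_lt_two
    rw [h2.fderiv] at hsurj
    obtain ⟨y, hy⟩ := hsurj 1
    simp at hy
  · have h1 := ambientIsotopic_weighted_curveCone Q.continuousOn ⟨Q.perm, Q.closes⟩ Q.disjoint ha
      (2 * k - 1) hρ
    have hk2 : 2 * k - 1 + 1 = 2 * k := by omega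
    rw [hk2] at h1
    have h2 : {x : Metric.sphere (0 : C2) ρ | P.toFun x = 0} = {x : Metric.sphere (0 : C2) ρ |
        (x : C2) 1 ≠ 0 ∧ ∃ j, ∃ t ∈ Set.Icc (0 : ℝ) (2 * Real.pi),
        (x : C2) 1 = ‖(x : C2) 1‖ * Complex.exp (t * Complex.I) ∧
        (x : C2) 0 = a * (‖(x : C2) 1‖ : ℂ) ^ (2 * k) * Q.strand j t} := by
      ext x
      constructor
      · intro hx
        have hx1 : (x : C2) 1 ≠ 0 := fun h => by
          have h3 := haxis x h hx
          have h4 := mem_sphere_zero_iff_norm.1 x.2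
          rw [h3, norm_zero] at h4
          exact hρ.ne h4
        exact ⟨hx1, (hzero x hx1).1 hx⟩
      · rintro ⟨hx1, hx⟩
        exact (hzero x hx1).2 hx
    have h3 : {x : Metric.sphere (0 : C2) ρ | ∃ y ∈ B.closure, (x : C2) = ρ • y} =
        {x : Metric.sphere (0 : C2) ρ | (x : C2) ∈ curveCone B.strand} :=
      Set.ext fun x => B.mem_smul_closure_iff hρ x
    rw [h2, h3]
    exact h1.trans (hBQ.ambientIsotopic hρ).symm

/-! ### Critical values -/

section CriticalValues

open Polynomial

theorem contDiff_coeff_rootPoly {ι : Type*} [Fintype ι] {z : ι → ℝ → ℂ}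
    (hz : ∀ j, ContDiff ℝ ∞ (z j)) (m : ℕ) :
    ContDiff ℝ ∞ fun t => (rootPoly fun j => z j t).coeff m := by
  classical
  unfold rootPoly
  generalize (Finset.univ : Finset ι) = S
  induction S using Finset.induction_on generalizing m with
  | empty => simpa using contDiff_const
  | insert i S hi ih =>
    simp only [Finset.prod_insert hi, coeff_mul, coeff_sub, coeff_C]
    refine ContDiff.sum fun p _ => (contDiff_const.sub ?_).mul (ih _)
    split_ifs
    · exact hz i
    · exact contDiff_const

/-- The critical values of a smooth family of polynomials with simple roots and simple critical
points are smooth functions without zeros: a critical point with the critical value `0` would be a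
double root. -/
theorem exists_contDiff_criticalValues {s : ℕ} (hs : 2 ≤ s) {z : Fin s → ℝ → ℂ}
    (hz : ∀ j, ContDiff ℝ ∞ (z j)) (hinj : ∀ t, Function.Injective fun j => z j t)
    (hcrit : ∀ t, HasSimpleCriticalPoints fun j => z j t) :
    ∃ v : Fin (s - 1) → ℝ → ℂ, (∀ j, ContDiff ℝ ∞ (v j)) ∧ (∀ j t, v j t ≠ 0) ∧
      ∀ t, (derivative (rootPoly fun j => z j t)).roots.map
          (fun c => (rootPoly fun j => z j t).eval c) =
        Finset.univ.val.map fun j => v j t := by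
  have hdeg : ∀ t, (derivative (rootPoly fun j => z j t)).natDegree = s - 1 := fun t => by
    rw [natDegree_derivative_rootPoly, Fintype.card_fin]
  have hlead : ∀ t, (derivative (rootPoly fun j => z j t)).coeff (s - 1) = s := fun t => by
    have h1 : (rootPoly fun j => z j t).coeff s = 1 := by
      have h2 := (rootPoly_monic fun j => z j t).coeff_natDegree
      rwa [natDegree_rootPoly, Fintype.card_fin] at h2
    have h3 : s - 1 + 1 = s := by omega
    rw [coeff_derivative, h3, h1, one_mul]
    exact_mod_cast h3
  have hcoeff : ∀ i, ContDiff ℝ ∞ fun t => (derivative (rootPoly fun j => z j t)).coeff i :=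
    fun i => by
      simp only [coeff_derivative]
      exact (contDiff_coeff_rootPoly hz (i + 1)).mul contDiff_const
  obtain ⟨c, hc, hroots⟩ := exists_contDiff_roots hdeg
    (b := s) (by exact_mod_cast (by omega : s ≠ 0)) hlead hcoeff hcrit
  refine ⟨fun j t => (rootPoly fun i => z i t).eval (c j t), fun j => ?_, fun j t h => ?_,
    fun t => ?_⟩
  · have h1 := contDiff_eval_family (Q := fun t => rootPoly fun i => z i t) (N := s + 1)
      (n := ⊤) (fun t => by rw [natDegree_rootPoly, Fintype.card_fin]; exact Nat.lt_succ_self s)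
      (contDiff_coeff_rootPoly hz)
    exact h1.comp (contDiff_id.prodMk (hc j))
  · have h1 : c j t ∈ (derivative (rootPoly fun i => z i t)).roots := by
      rw [hroots]
      exact Multiset.mem_map_of_mem _ (Finset.mem_univ_val j)
    have h2 := isRoot_of_mem_roots h1
    simp only [eval_rootPoly, Finset.prod_eq_zero_iff] at h
    obtain ⟨i, -, hi⟩ := h
    obtain ⟨d, hd, hd0⟩ := exists_hasDerivAt_prod_sub_ne_zero (hinj t) i
    have h3 := (rootPoly fun i => z i t).hasDerivAt (z i t)
    simp only [eval_rootPoly] at h3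
    rw [hd.unique h3, ← sub_eq_zero.1 hi] at hd0
    exact hd0 h2
  · rw [hroots, Multiset.map_map]
    rfl

end CriticalValues

/-! ### The Fourier parametrization -/

theorem apply_add_nat_mul_two_pi {ι : Type*} {h : ι → ℝ → ℂ} {σ : Equiv.Perm ι}
    (hσ : ∀ j t, h j (t + 2 * Real.pi) = h (σ j) t) (n : ℕ) (j : ι) (t : ℝ) :
    h j (t + n * (2 * Real.pi)) = h ((σ ^ n) j) t := by
  induction n generalizing t with
  | zero => simp
  | succ n ih =>
    have h1 : t + ((n + 1 : ℕ) : ℝ) * (2 * Real.pi) = t + 2 * Real.pi + n * (2 * Real.pi) := by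
      push_cast
      ring
    rw [h1, ih, hσ, pow_succ', Equiv.Perm.mul_apply]

/-- Exponential polynomials `h_i` that are permuted by the translation by `2π`, run through at double
speed, have a Fourier parametrization: on a cycle of length `m` of the square of the permutation,
they are all translates of one function of period `2πm`. -/
theorem exists_fourierData {s : ℕ} {h : Fin s → ℝ → ℂ} (hh : ∀ j, h j ∈ expPoly)
    {σ : Equiv.Perm (Fin s)} (hσ : ∀ j t, h j (t + 2 * Real.pi) = h (σ j) t) :
    ∃ D : FourierData s, ∀ C j t, D.root C j t = h (D.label.symm ⟨C, j⟩) (2 * t) := by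
  obtain ⟨n, len, label, x, hlen, hx, hlabel⟩ := (σ ^ 2).exists_cycle_labelling
  -- the translation by `-4π` accounts for the index `j + 1` in `FourierData.root`
  let f : Fin n → ℝ → ℂ := fun C θ => h (x C) (2 * len C * θ + -(4 * Real.pi))
  have hf : ∀ C, ∃ (N : ℕ) (c : ℤ → ℂ), ∀ t : ℝ,
      f C t = ∑ l ∈ Finset.Icc (-(N : ℤ)) N, c l * Complex.exp (Complex.I * l * t) := fun C => by
    refine exists_fourier_of_periodic (comp_affine_mem_expPoly _ _ (hh (x C))) fun t => ?_
    have h1 : 2 * len C * (t + 2 * Real.pi) + -(4 * Real.pi) =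
        2 * len C * t + -(4 * Real.pi) + (2 * len C : ℕ) * (2 * Real.pi) := by
      push_cast
      ring
    simp only [f]
    rw [h1, apply_add_nat_mul_two_pi hσ, pow_mul, hx]
  choose N c hc using hf
  refine ⟨⟨n, len, hlen, label, fun C θ => (f C θ).re, fun C θ => (f C θ).im,
    fun C => isTrigPolynomial_re (hc C), fun C => isTrigPolynomial_im (hc C)⟩, fun C j t => ?_⟩
  have h0 : (len C : ℝ) ≠ 0 := by exact_mod_cast (hlen C).ne'
  have h1 : 2 * (len C : ℝ) * ((t + 2 * Real.pi * ((j : ℝ) + 1)) / len C) + -(4 * Real.pi) =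
      2 * t + (2 * (j : ℕ) : ℕ) * (2 * Real.pi) := by
    field_simp
    push_cast
    ring
  simp only [FourierData.root, f]
  rw [h1, apply_add_nat_mul_two_pi hσ, pow_mul, hlabel, mul_comm Complex.I, Complex.re_add_im]

theorem FourierData.g_eq_rootPoly {s : ℕ} {D : FourierData s} {z : Fin s → ℝ → ℂ}
    (hD : ∀ C j t, D.root C j t = z (D.label.symm ⟨C, j⟩) t) (a t : ℝ) :
    D.g a t = rootPoly fun i => (a : ℂ) * z i t := by
  simp only [FourierData.g, hD]
  rw [rootPoly, ← D.label.symm.prod_comp, Fintype.prod_sigma]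

/-! ### Approximation of a square braid -/

namespace GeometricBraid

variable {s : ℕ} (w : GeometricBraid s)

theorem square_strand_eq_extend (j : Fin s) {t : ℝ} (ht : t ∈ Set.Icc (0 : ℝ) (2 * Real.pi)) :
    w.square.strand j t = w.extend j (2 * t) := by
  simp only [square]
  split_ifs with h
  · rw [w.extend_eq_strand j ⟨by linarith [ht.1], by linarith⟩]
  · have h1 : 2 * t = 2 * t - 2 * Real.pi + 2 * Real.pi := by ring
    conv_rhs => rw [h1]
    rw [w.extend_add, w.extend_eq_strand _ ⟨by linarith, by linarith [ht.2]⟩]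

theorem exists_strand_extend_eq (t : ℝ) : ∃ t' ∈ Set.Icc (0 : ℝ) (2 * Real.pi),
    ∃ π : Equiv.Perm (Fin s), ∀ j, w.extend j t = w.strand (π j) t' := by
  have hpi := Real.two_pi_pos
  refine ⟨t - 2 * Real.pi * ⌊t / (2 * Real.pi)⌋, ⟨?_, ?_⟩, _, fun j => rfl⟩
  · have h1 := (le_div_iff₀ hpi).1 (Int.floor_le (t / (2 * Real.pi)))
    linarith
  · have h1 := (div_lt_iff₀ hpi).1 (Int.lt_floor_add_one (t / (2 * Real.pi)))
    linarith

/-- A lower bound for the distances between the strands, and for the distances between the first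
coordinates of the starting points. -/
theorem exists_separation : ∃ δ > 0,
    (∀ t, ∀ i j, i ≠ j → δ ≤ ‖w.extend i t - w.extend j t‖) ∧
    ∀ i j, i < j → (w.strand i 0).re + δ ≤ (w.strand j 0).re := by
  have h1 : ∀ i j, i ≠ j → ∃ d > 0, ∀ t ∈ Set.Icc (0 : ℝ) (2 * Real.pi),
      d ≤ ‖w.strand i t - w.strand j t‖ := fun i j hij =>
    isCompact_Icc.exists_forall_le' (((w.continuousOn i).sub (w.continuousOn j)).norm)
      fun t ht => norm_pos_iff.2 (sub_ne_zero.2 fun h => hij (w.disjoint t ht h))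
  have h2 : ∀ᶠ δ in 𝓝[>] (0 : ℝ), ∀ i j, i ≠ j → ∀ t ∈ Set.Icc (0 : ℝ) (2 * Real.pi),
      δ ≤ ‖w.strand i t - w.strand j t‖ := by
    refine Filter.eventually_all.2 fun i => Filter.eventually_all.2 fun j => ?_
    by_cases hij : i = j
    · exact Filter.Eventually.of_forall fun δ h => absurd hij h
    · obtain ⟨d, hd, h⟩ := h1 i j hij
      filter_upwards [(eventually_le_nhds hd).filter_mono nhdsWithin_le_nhds] with δ hδ _ t ht
      exact hδ.trans (h t ht)
  have h3 : ∀ᶠ δ in 𝓝[>] (0 : ℝ), ∀ i j, i < j → (w.strand i 0).re + δ ≤ (w.strand j 0).re := by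
    refine Filter.eventually_all.2 fun i => Filter.eventually_all.2 fun j => ?_
    by_cases hij : i < j
    · have h : 0 < (w.strand j 0).re - (w.strand i 0).re := sub_pos.2 (w.ordered hij)
      filter_upwards [(eventually_le_nhds h).filter_mono nhdsWithin_le_nhds] with δ hδ _
      linarith
    · exact Filter.Eventually.of_forall fun δ h => absurd h hij
  obtain ⟨δ, ⟨hδ2, hδ3⟩, hδ⟩ := ((h2.and h3).and self_mem_nhdsWithin).exists
  refine ⟨δ, hδ, fun t i j hij => ?_, hδ3⟩
  obtain ⟨t', ht', π, hπ⟩ := w.exists_strand_extend_eq t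
  rw [hπ, hπ]
  exact hδ2 _ _ (fun h => hij (π.injective h)) t' ht'

/-- A square braid is isotopic to a braid whose strands `h_j(2t)` are exponential polynomials without
zeros, permuted by the translation by `2π`, such that the polynomials with these roots have simple
critical points. -/
theorem exists_isotopic_square (hs : 2 ≤ s) : ∃ h : Fin s → ℝ → ℂ, (∀ j, h j ∈ expPoly) ∧
    (∀ j t, h j (t + 2 * Real.pi) = h (w.perm j) t) ∧ (∀ j t, h j t ≠ 0) ∧
    (∀ t, Function.Injective fun j => h j t) ∧
    (∀ t, HasSimpleCriticalPoints fun j => h j t) ∧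
    ∃ Q : GeometricBraid s, (∀ j t, Q.strand j t = h j (2 * t)) ∧ Isotopic w.square Q := by
  obtain ⟨δ, hδ, hsep, hre⟩ := w.exists_separation
  obtain ⟨f, hf, hfσ, hfδ, hcrit⟩ := w.exists_approx_hasSimpleCriticalPoints hs
    (by positivity : 0 < δ / 4)
  obtain ⟨M, hM⟩ := w.exists_norm_strand_le
  -- a large translation moves the strands away from `0`
  let b : ℂ := ((M + δ : ℝ) : ℂ)
  let h : Fin s → ℝ → ℂ := fun j t => f j t + b
  have hclose : ∀ t i j,
      ‖(h i t - h j t) - (w.extend i t - w.extend j t)‖ < δ / 2 := fun t i j => by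
    calc _ = ‖(f i t - w.extend i t) - (f j t - w.extend j t)‖ := by
          congr 1
          simp only [h]
          ring
      _ ≤ _ := norm_sub_le _ _
      _ < δ / 4 + δ / 4 := add_lt_add (hfδ i t) (hfδ j t)
      _ = δ / 2 := by ring
  have hinj : ∀ t, Function.Injective fun j => h j t := fun t i j hij => by
    by_contra hne
    have h1 := hclose t i j
    have h2 : h i t - h j t = 0 := sub_eq_zero.2 hij
    rw [h2, zero_sub, norm_neg] at h1
    linarith [hsep t i j hne]
  have hhσ : ∀ j t, h j (t + 2 * Real.pi) = h (w.perm j) t := fun j t => by simp only [h, hfσ]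
  have hh : ∀ j, h j ∈ expPoly := fun j => expPoly.add_mem (hf j) (const_mem_expPoly b)
  refine ⟨h, hh, hhσ, fun j t h0 => ?_, hinj, fun t => ?_, ⟨fun j t => h j (2 * t),
    w.perm * w.perm, fun j => ?_, fun t _ => hinj (2 * t), fun i j hij => ?_, fun j => ?_⟩,
    fun j t => rfl, ?_⟩
  · obtain ⟨t', ht', π, hπ⟩ := w.exists_strand_extend_eq t
    have h1 : ‖f j t‖ < M + δ := by
      have h2 := norm_le_norm_add_norm_sub (w.extend j t) (f j t)
      have h3 := hM (π j) t' ht'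
      rw [← hπ] at h3
      have h4 := hfδ j t
      rw [norm_sub_rev] at h2
      linarith
    have h2 : f j t = -b := eq_neg_of_add_eq_zero_left h0
    rw [h2, norm_neg, Complex.norm_real, Real.norm_eq_abs] at h1
    linarith [le_abs_self (M + δ)]
  · have h1 := (hcrit t).affine one_ne_zero b
    simpa only [one_mul] using h1
  · exact ((contDiff_of_mem_expPoly (hh j)).continuous.comp (by fun_prop)).continuousOn
  · have h0 : ∀ j, |(f j 0).re - (w.strand j 0).re| < δ / 4 := fun j => by
      rw [← w.extend_eq_strand j ⟨le_rfl, Real.two_pi_pos.le⟩, ← Complex.sub_re]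
      exact (Complex.abs_re_le_norm _).trans_lt (hfδ j 0)
    have hi := abs_lt.1 (h0 i)
    have hj := abs_lt.1 (h0 j)
    have h1 := hre i j hij
    simp only [h, mul_zero, Complex.add_re]
    linarith [hi.1, hi.2, hj.1, hj.2]
  · have h1 := apply_add_nat_mul_two_pi hhσ 2 j 0
    rw [zero_add, pow_two] at h1
    simp only [mul_zero]
    rw [← h1]
    norm_num
  · refine isotopic_of_close rfl fun t ht i j hij => ?_
    rw [w.square_strand_eq_extend i ht, w.square_strand_eq_extend j ht]
    exact (hclose (2 * t) i j).trans_le (by linarith [hsep (2 * t) i j hij])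

end GeometricBraid

theorem mainTheorem6 (s : ℕ) (hs : 2 ≤ s) (B : GeometricBraid s) (hB : B.IsSquare) :
    ∃ D : FourierData s, D.Parametrizes B ∧
      ∃ (a₀ : ℝ) (k₀ : ℕ), 0 < a₀ ∧ ∀ a : ℝ, 0 < a → a ≤ a₀ →
        (∃ v : Fin (s - 1) → ℝ → ℂ,
          (∀ j, ContDiff ℝ ∞ (v j)) ∧ (∀ j t, v j t ≠ 0) ∧
          ∀ t : ℝ, (Polynomial.derivative (D.g a t)).roots.map (fun c => (D.g a t).eval c) =
            Finset.univ.val.map (fun j => v j t)) ∧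
        (0 : ℂ) ∉ Set.range (D.psi₀ a) ∧
        ∀ k : ℕ, k₀ ≤ k → ∃ P : MixedPolynomial, D.IsP a k P ∧ IsWeakRealization P B.closure := by
  obtain ⟨w, hBw⟩ := hB
  obtain ⟨h, hh, hσ, h0, hinj, hcrit, Q, hQ, hwQ⟩ := w.exists_isotopic_square hs
  obtain ⟨D, hD⟩ := exists_fourierData hh hσ
  have hBQ : B.Isotopic Q := hBw.trans hwQ
  have hg := FourierData.g_eq_rootPoly (z := fun i t => h i (2 * t)) hD
  obtain ⟨k₀, hk₀⟩ := exists_mixedPolynomial_eq_prod hh hσ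
  refine ⟨D, ⟨Q, fun i t _ => ?_, hBQ⟩, 1, max k₀ 1, one_pos, fun a ha _ => ⟨?_, ?_, fun k hk => ?_⟩⟩
  · rw [hQ, hD, Sigma.eta, Equiv.symm_apply_apply]
  · have ha' : (a : ℂ) ≠ 0 := by exact_mod_cast ha.ne'
    simp only [hg]
    refine exists_contDiff_criticalValues hs (z := fun i t => (a : ℂ) * h i (2 * t))
      (fun j => ?_) (fun t i j hij => ?_) fun t => ?_
    · exact contDiff_const.mul
        ((contDiff_of_mem_expPoly (hh j)).comp (contDiff_const.mul contDiff_id))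
    · exact hinj (2 * t) (mul_left_cancel₀ ha' hij)
    · have h1 := (hcrit (2 * t)).affine ha' 0
      simpa only [add_zero] using h1
  · rintro ⟨t, ht⟩
    refine mul_ne_zero (pow_ne_zero _ ?_) ?_ ht
    · exact_mod_cast ha.ne'
    · refine Finset.prod_ne_zero_iff.2 fun C _ => Finset.prod_ne_zero_iff.2 fun j _ => ?_
      rw [hD]
      exact h0 _ _
  · have hk1 : 1 ≤ k := (le_max_right _ _).trans hk
    obtain ⟨P, hvars, hP0, hP⟩ := hk₀ a ha k ((le_max_left _ _).trans hk) hk1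
    refine ⟨P, ⟨hvars, fun u v t hv hvt => ?_⟩,
      isWeakRealization_of_eq_prod hs hBQ ha hk1 hP0 fun u v t _ hv hvt => ?_⟩
    · have hr : (‖v‖ : ℂ) ≠ 0 := by exact_mod_cast norm_ne_zero_iff.2 hv
      have h1 : v * conj v = (‖v‖ : ℂ) ^ 2 := Complex.mul_conj' v
      have h2 : ((‖v‖ : ℂ) ^ 2) ^ (s * k) = ∏ _j : Fin s, (‖v‖ : ℂ) ^ (2 * k) := by
        rw [Finset.prod_const, Finset.card_univ, Fintype.card_fin, ← pow_mul, ← pow_mul]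
        congr 1
        ring
      rw [hP u v t hv (by rw [← hvt, mul_div_cancel₀ _ hr]), hg, eval_rootPoly, h1, h2, ← pow_mul,
        ← Finset.prod_mul_distrib]
      refine Finset.prod_congr rfl fun j _ => ?_
      field_simp
    · simp only [hQ]
      exact hP u v t hv hvt
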